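/- Let $S^1,S^2$ be finite sets (local states of sites $1$ and $2$), let $Q=S^1\cap S^2$ be nonempty, and assume $S^i\setminus Q\neq\emptyset$ for $i=1,2$. The $Q$-sequence induced by a (finite or infinite) sequence is the sequence of its elements lying in $Q$, in their order of appearance. A finite trajectory is a pair $s=(s^1,s^2)$ of finite sequences in $S^1$ and $S^2$ inducing the same $Q$-sequence. Let $\Omega$ be the set of pairs $\omega=(\omega^1,\omega^2)$ of infinite sequences in $S^1$ and $S^2$ inducing the same $Q$-sequence, with the trace of the product $\sigma$-algebra, and let $\uparrow s$ be the set of $\omega\in\Omega$ such that $s^i$ is a prefix of $\omega^i$ for $i=1,2$. For $\alpha=(x,z)\in S^1\times S^2$ let $\gamma_\alpha(s)$ be the pair of last states of $x\cdot s^1$ and $z\cdot s^2$. A finite trajectory is elementary if its induced $Q$-sequence has exactly one term $q$, and $q$ is the last state of both components; then $\gamma_\alpha(s)=(q,q)$ is independent of $\alpha$ and written $\gamma(s)$. Let $Y=(Y_n)_{n\ge0}$ be the $Q$-sequence induced by $\omega\in\Omega$, continued by a constant value $*\notin S^1\cup S^2$ if it is finite. Let $X_0$ be a set of global states (elements of $S^1\times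 S^2$). A Markov two-components process is a family $(\mathbf P_\alpha)_{\alpha\in X_0}$ of probability measures on $\Omega$ such that, for every $\alpha\in X_0$ and every finite trajectory $s$ with $\mathbf P_\alpha(\uparrow s)>0$, one has $\gamma_\alpha(s)\in X_0$ and $\mathbf P_{\gamma_\alpha(s)}(\uparrow t)=\mathbf P_\alpha(\uparrow(s\cdot t))/\mathbf P_\alpha(\uparrow s)$ for all finite trajectories $t$. It has the Local Independence Property if moreover, for every $\alpha\in X_0$, $\omega^1$ and $\omega^2$ are independent conditionally on $Y$ with respect to $\mathbf P_\alpha$, that is, $\mathbf E_\alpha(\varphi_1\varphi_2\mid Y)=\mathbf E_\alpha(\varphi_1\mid Y)\,\mathbf E_\alpha(\varphi_2\mid Y)$ almost surely for all nonnegative bounded variables $\varphi_1,\varphi_2$ measurable with respect to $\omega^1$ and $\omega^2$ respectively. For $i=1,2$ let $M^i$ be a stochastic matrix on $S^i$ with positive coefficients, and let $M^i_x$ be the law of the Markov chain $(X^i_n)_{n\ge0}$ with transition matrix $M^i$ and $X^i_0=x$. Put $\tau^i=\inf\{n>0: X^i_n\in Q\}$ and $\Delta=\{\tau^1<\infty,\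 \tau^2<\infty,\ X^1_{\tau^1}=X^2_{\tau^2}\}$. For $\alpha=(x,z)$ let $U_\alpha$ be the law of the elementary trajectory $(X^1_1\cdots X^1_{\tau^1},\,X^2_1\cdots X^2_{\tau^2})$ under $M^1_x\otimes M^2_z(\,\cdot\mid\Delta)$. The synchronization product of the two chains is the family $(\mathbf P_\alpha)_{\alpha\in X_0}$ with $X_0=\{(x,z)\in S^1\times S^2: x\in Q\wedge z\in Q\Rightarrow x=z\}$, where $\mathbf P_\alpha$ is the law of the infinite concatenation $\sigma_0\cdot\sigma_1\cdot\sigma_2\cdots$, $(\sigma_n)_{n\ge0}$ being the Markov chain on the countable set of elementary trajectories with initial law $U_\alpha$ and transition kernel $K(\sigma,\cdot)=U_{\gamma(\sigma)}$. Then the synchronization product of the two Markov chains is a Markov two-components process that has the Local Independence Property. -/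

import Mathlib

open MeasureTheory ProbabilityTheory

noncomputable section

namespace TwoSite

/- Local states.  The state sets of the two sites are finite sets `S₁`, `S₂` of some type `A`,
the set of shared states is `Q = S₁ ∩ S₂`.  Finite sets of states carry the discrete
`σ`-algebra. -/

instance stateMeasurableSpace {A : Type*} (S : Finset A) : MeasurableSpace S := ⊤

instance stateDiscrete {A : Type*} (S : Finset A) : DiscreteMeasurableSpace S :=
  ⟨fun _ => trivial⟩

section Sequences

lemma measurableSet_mem {A : Type*} (Q : Finset A) {S : Finset A} (n : ℕ) :
    MeasurableSet {x : ℕ → S | (x n : A) ∈ Q} :=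
  measurableSet_preimage (f := fun x : ℕ → S => x n) (measurable_pi_apply n)
    (MeasurableSet.of_discrete (s := {a : S | (a : A) ∈ Q}))

variable {A : Type*} [DecidableEq A]

/-- The `Q`-sequence induced by a finite sequence of states. -/
def listInduced (Q : Finset A) {S : Finset A} (l : List S) : List A :=
  (l.map (fun a : S => (a : A))).filter (fun a => a ∈ Q)

/-- The `Q`-sequence induced by an infinite sequence of states, its `n`-th term (`n ≥ 0`) being the
`n`-th element of `Q` met by `x`.  It is continued by the constant `none` (in the role of the extra
value `*`) if it is finite. -/
def seqInduced (Q : Finset A) {S : Finset A} (x : ℕ → S) (n : ℕ) : Option A :=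
  open Classical in
  if ∃ k, (x k : A) ∈ Q ∧ Nat.count (fun j => (x j : A) ∈ Q) k = n then
    some (x (Nat.nth (fun j => (x j : A) ∈ Q) n) : A)
  else none

/-- The prefix of length `n` of an infinite sequence. -/
def seqTake {E : Type*} (x : ℕ → E) (n : ℕ) : List E := (List.range n).map x

/-- The finite sequence `l` is a prefix of the infinite sequence `x`. -/
def IsSeqPrefix {E : Type*} (l : List E) (x : ℕ → E) : Prop := seqTake x l.length = l

lemma seqTake_succ {E : Type*} (x : ℕ → E) (n : ℕ) : seqTake x (n + 1) = seqTake x n ++ [x n] := by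
  simp [seqTake, List.range_succ]

lemma listInduced_append (Q : Finset A) {S : Finset A} (l m : List S) :
    listInduced Q (l ++ m) = listInduced Q l ++ listInduced Q m := by
  simp [listInduced]

lemma length_listInduced_seqTake (Q : Finset A) {S : Finset A} (x : ℕ → S) (n : ℕ) :
    (listInduced Q (seqTake x n)).length = Nat.count (fun j => (x j : A) ∈ Q) n := by
  induction n with
  | zero => simp [seqTake, listInduced]
  | succ n ih =>
    rw [seqTake_succ, listInduced_append, List.length_append, ih, Nat.count_succ]
    by_cases h : (x n : A) ∈ Q <;> simp [listInduced, h]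

lemma seqInduced_eq_some (Q : Finset A) {S : Finset A} (x : ℕ → S) (N n : ℕ) (a : A)
    (h : (listInduced Q (seqTake x N))[n]? = some a) : seqInduced Q x n = some a := by
  induction N with
  | zero => simp [seqTake, listInduced] at h
  | succ N ih =>
    rw [seqTake_succ, listInduced_append] at h
    by_cases hn : n < (listInduced Q (seqTake x N)).length
    · rw [List.getElem?_append_left hn] at h
      exact ih h
    · rw [List.getElem?_append_right (not_lt.1 hn)] at h
      by_cases hN : (x N : A) ∈ Q
      · have h1 : listInduced Q [x N] = [(x N : A)] := by simp [listInduced, hN]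
        rw [h1, List.getElem?_singleton] at h
        split_ifs at h with h0
        have hc : Nat.count (fun j => (x j : A) ∈ Q) N = n := by
          rw [← length_listInduced_seqTake]; omega
        have hnth : Nat.nth (fun j => (x j : A) ∈ Q) n = N := by
          rw [← hc]; exact Nat.nth_count (p := fun j => (x j : A) ∈ Q) hN
        unfold seqInduced
        rw [if_pos ⟨N, hN, hc⟩, hnth]
        exact h
      · simp [listInduced, hN] at h

lemma measurable_seqInduced (Q : Finset A) {S : Finset A} (n : ℕ) :
    Measurable[MeasurableSpace.pi, ⊤] (fun x : ℕ → S => seqInduced Q x n) := by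
  have hcount : ∀ k, Measurable fun x : ℕ → S => Nat.count (fun j => (x j : A) ∈ Q) k := by
    intro k
    induction k with
    | zero => simp only [Nat.count_zero]; exact measurable_const
    | succ k ih =>
      simp only [Nat.count_succ]
      exact ih.add (Measurable.ite (measurableSet_mem Q k) measurable_const measurable_const)
  have hC : ∀ k, MeasurableSet
      {x : ℕ → S | (x k : A) ∈ Q ∧ Nat.count (fun j => (x j : A) ∈ Q) k = n} := fun k =>
    (measurableSet_mem Q k).inter (hcount k (MeasurableSet.of_discrete (s := {n})))
  intro U _
  have h : (fun x : ℕ → S => seqInduced Q x n) ⁻¹' U =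
      (⋃ k, {x : ℕ → S | (x k : A) ∈ Q ∧ Nat.count (fun j => (x j : A) ∈ Q) k = n} ∩
        {x : ℕ → S | some (x k : A) ∈ U}) ∪
      ((⋃ k, {x : ℕ → S | (x k : A) ∈ Q ∧ Nat.count (fun j => (x j : A) ∈ Q) k = n})ᶜ ∩
        {_x | none ∈ U}) := by
    ext x
    simp only [Set.mem_preimage, Set.mem_union, Set.mem_iUnion, Set.mem_inter_iff,
      Set.mem_ofPred_eq, Set.mem_compl_iff, seqInduced]
    have hk : ∀ k, (x k : A) ∈ Q ∧ Nat.count (fun j => (x j : A) ∈ Q) k = n →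
        Nat.nth (fun j => (x j : A) ∈ Q) n = k := by
      rintro k ⟨h1, rfl⟩
      exact Nat.nth_count (p := fun j => (x j : A) ∈ Q) h1
    by_cases hx : ∃ k, (x k : A) ∈ Q ∧ Nat.count (fun j => (x j : A) ∈ Q) k = n
    · rw [if_pos hx]
      constructor
      · intro hU
        obtain ⟨k, hkx⟩ := hx
        exact Or.inl ⟨k, hkx, by rwa [hk k hkx] at hU⟩
      · rintro (⟨k, hkx, hU⟩ | ⟨h, -⟩)
        · rwa [hk k hkx]
        · exact absurd hx h
    · rw [if_neg hx]
      constructor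
      · exact fun hU => Or.inr ⟨hx, hU⟩
      · rintro (⟨k, hkx, -⟩ | ⟨-, hU⟩)
        · exact absurd ⟨k, hkx⟩ hx
        · exact hU
  rw [h]
  refine (MeasurableSet.iUnion fun k => (hC k).inter ?_).union
    ((MeasurableSet.iUnion hC).compl.inter (MeasurableSet.const _))
  exact measurableSet_preimage (f := fun x : ℕ → S => x k) (measurable_pi_apply k)
    (MeasurableSet.of_discrete (s := {a : S | some (a : A) ∈ U}))

/-- The infinite concatenation `L 0 · L 1 · L 2 ⋯` of nonempty finite sequences. -/
def seqConcat {E : Type*} (L : ℕ → List E) (hL : ∀ k, L k ≠ []) (n : ℕ) : E :=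
  ((List.range (n + 1)).map L).flatten[n]'(by
    have key : ∀ m, m ≤ (((List.range m).map L).flatten).length := by
      intro m
      induction m with
      | zero => simp
      | succ m ih =>
        have := List.length_pos_iff.2 (hL m)
        simp only [List.range_succ, List.map_append, List.map_cons, List.map_nil,
          List.flatten_append, List.flatten_cons, List.flatten_nil, List.append_nil,
          List.length_append]
        omega
    exact key (n + 1))

end Sequences

section Trajectories

variable {A : Type*} [DecidableEq A] (S₁ S₂ : Finset A)

/-- Finite trajectories: pairs of finite local trajectories that synchronize. -/
def FinTraj : Type _ :=
  {s : List S₁ × List S₂ // listInduced (S₁ ∩ S₂) s.1 = listInduced (S₁ ∩ S₂) s.2}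

/-- The space `Ω` of maximal trajectories: pairs of infinite local trajectories that synchronize.
Its `σ`-algebra is the trace of the product `σ`-algebra. -/
abbrev MaxTraj : Type _ :=
  {ω : (ℕ → S₁) × (ℕ → S₂) // seqInduced (S₁ ∩ S₂) ω.1 = seqInduced (S₁ ∩ S₂) ω.2}

variable {S₁ S₂}

/-- The elementary cylinder `↑s` of base `s`. -/
def FinTraj.cylinder (s : FinTraj S₁ S₂) : Set (MaxTraj S₁ S₂) :=
  {ω | IsSeqPrefix s.1.1 ω.1.1 ∧ IsSeqPrefix s.1.2 ω.1.2}

/-- Concatenation of finite trajectories. -/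
def FinTraj.append (s t : FinTraj S₁ S₂) : FinTraj S₁ S₂ :=
  ⟨(s.1.1 ++ t.1.1, s.1.2 ++ t.1.2), by
    simp only [listInduced_append]; rw [s.2, t.2]⟩

/-- The global state `γ_α(s)` reached after the finite trajectory `s`, starting from `α`. -/
def FinTraj.gamma (α : S₁ × S₂) (s : FinTraj S₁ S₂) : S₁ × S₂ :=
  (s.1.1.getLastD α.1, s.1.2.getLastD α.2)

/-- An elementary trajectory is a finite trajectory with a unique synchronization, which occurs at
its end (on both sites). -/
def FinTraj.IsElementary (s : FinTraj S₁ S₂) : Prop :=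
  ∃ q : A, listInduced (S₁ ∩ S₂) s.1.1 = [q] ∧
    s.1.1.getLast?.map (fun a : S₁ => (a : A)) = some q ∧
    s.1.2.getLast?.map (fun a : S₂ => (a : A)) = some q

/-- The synchronization sequence `Y = (Y_n)_{n ≥ 0}`, with `none` in the role of `*`. -/
def syncSeq (n : ℕ) (ω : MaxTraj S₁ S₂) : Option A := seqInduced (S₁ ∩ S₂) ω.1.1 n

/-- The `σ`-algebra `⟨Y⟩` generated by the synchronization sequence (the constant `Y_{-1} = *` does
not contribute). -/
@[reducible]
def syncSigma : MeasurableSpace (MaxTraj S₁ S₂) :=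
  ⨆ n : ℕ, MeasurableSpace.comap (syncSeq n) ⊤

lemma syncSigma_le : (syncSigma : MeasurableSpace (MaxTraj S₁ S₂)) ≤
    Subtype.instMeasurableSpace := by
  refine iSup_le fun n => ?_
  rintro _ ⟨U, hU, rfl⟩
  exact (measurable_fst.comp measurable_subtype_coe) (measurable_seqInduced _ n hU)

variable (S₁ S₂) in
/-- The countable set of elementary trajectories. -/
def Elem : Type _ := {s : FinTraj S₁ S₂ // s.IsElementary}

instance : MeasurableSpace (Elem S₁ S₂) := ⊤

instance : DiscreteMeasurableSpace (Elem S₁ S₂) := ⟨fun _ => trivial⟩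

instance : Countable (Elem S₁ S₂) := by
  have h : Countable (FinTraj S₁ S₂) := by unfold FinTraj; infer_instance
  unfold Elem
  infer_instance

lemma Elem.left_ne_nil (σ : Elem S₁ S₂) : σ.1.1.1 ≠ [] := by
  obtain ⟨q, -, h, -⟩ := σ.2
  intro h0
  simp [h0] at h

lemma Elem.right_ne_nil (σ : Elem S₁ S₂) : σ.1.1.2 ≠ [] := by
  obtain ⟨q, -, -, h⟩ := σ.2
  intro h0
  simp [h0] at h

/-- The global state `γ(σ)` reached after an elementary trajectory (no initial state is needed). -/
def Elem.gamma (σ : Elem S₁ S₂) : S₁ × S₂ :=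
  (σ.1.1.1.getLast σ.left_ne_nil, σ.1.1.2.getLast σ.right_ne_nil)

lemma seqTake_seqConcat {E : Type*} (L : ℕ → List E) (hL : ∀ k, L k ≠ []) (m : ℕ) :
    seqTake (seqConcat L hL) (((List.range m).map L).flatten).length =
      ((List.range m).map L).flatten := by
  have pre : ∀ a b, a ≤ b → ((List.range a).map L).flatten <+: ((List.range b).map L).flatten := by
    intro a b hab
    obtain ⟨c, rfl⟩ := Nat.exists_eq_add_of_le hab
    rw [List.range_add, List.map_append, List.flatten_append]
    exact List.prefix_append _ _
  refine List.ext_getElem (by simp [seqTake]) fun i h1 h2 => ?_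
  simp only [seqTake, List.getElem_map, List.getElem_range, seqConcat]
  rcases le_total (i + 1) m with h | h
  · exact (pre _ _ h).getElem _
  · exact ((pre _ _ h).getElem _).symm

/-- The maximal trajectory obtained as the infinite concatenation `σ 0 · σ 1 · σ 2 ⋯` of
elementary trajectories. -/
def concat (σ : ℕ → Elem S₁ S₂) : MaxTraj S₁ S₂ :=
  ⟨(seqConcat (fun k => (σ k).1.1.1) (fun k => (σ k).left_ne_nil),
    seqConcat (fun k => (σ k).1.1.2) (fun k => (σ k).right_ne_nil)), by
    choose q hq _ _ using fun k => (σ k).2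
    have hq' : ∀ k, listInduced (S₁ ∩ S₂) (σ k).1.1.2 = [q k] := fun k => by
      rw [← (σ k).1.2]; exact hq k
    have key : ∀ {S : Finset A} (L : ℕ → List S) (hL : ∀ k, L k ≠ [])
        (_ : ∀ k, listInduced (S₁ ∩ S₂) (L k) = [q k]) (n : ℕ),
        seqInduced (S₁ ∩ S₂) (seqConcat L hL) n = some (q n) := by
      intro S L hL hLq n
      have hfl : ∀ m, listInduced (S₁ ∩ S₂) (((List.range m).map L).flatten) =
          (List.range m).map q := by
        intro m
        induction m with
        | zero => simp [listInduced]
        | succ m ih =>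
          simp only [List.range_succ, List.map_append, List.map_cons, List.map_nil,
            List.flatten_append, List.flatten_cons, List.flatten_nil, List.append_nil,
            listInduced_append]
          rw [ih, hLq]
      refine seqInduced_eq_some _ _ (((List.range (n + 1)).map L).flatten).length n _ ?_
      rw [seqTake_seqConcat, hfl]
      simp
    funext n
    exact (key (fun k => (σ k).1.1.1) (fun k => (σ k).left_ne_nil) hq n).trans
      (key (fun k => (σ k).1.1.2) (fun k => (σ k).right_ne_nil) hq' n).symm⟩

lemma measurable_concat : Measurable (concat : (ℕ → Elem S₁ S₂) → MaxTraj S₁ S₂) := by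
  have key : ∀ {S : Finset A} (f : Elem S₁ S₂ → List S) (hf : ∀ σ, f σ ≠ []),
      Measurable fun σ : ℕ → Elem S₁ S₂ => seqConcat (fun k => f (σ k)) (fun k => hf (σ k)) := by
    intro S f hf
    refine measurable_pi_lambda _ fun n => ?_
    let ext : (Fin (n + 1) → Elem S₁ S₂) → ℕ → Elem S₁ S₂ :=
      fun v k => if h : k < n + 1 then v ⟨k, h⟩ else v 0
    let g : (Fin (n + 1) → Elem S₁ S₂) → S := fun v =>
      seqConcat (fun k => f (ext v k)) (fun k => hf (ext v k)) n
    have hg : Measurable g := measurable_of_countable g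
    have hr : Measurable fun (σ : ℕ → Elem S₁ S₂) (i : Fin (n + 1)) => σ i :=
      measurable_pi_lambda _ fun i => measurable_pi_apply _
    convert hg.comp hr using 1
    funext σ
    have hl : (List.range (n + 1)).map (fun k => f (σ k)) =
        (List.range (n + 1)).map (fun k => f (ext (fun i => σ i) k)) := by
      refine List.map_congr_left fun k hk => ?_
      simp [ext, Nat.lt_succ_iff.1 (List.mem_range.1 hk)]
    simp only [seqConcat, Function.comp_apply, g, hl]
  exact Measurable.subtype_mk ((key (fun σ => σ.1.1.1) Elem.left_ne_nil).prodMk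
    (key (fun σ => σ.1.1.2) Elem.right_ne_nil))

end Trajectories

section Processes

variable {A : Type*} [DecidableEq A] {S₁ S₂ : Finset A}

/-- `(P α)`, for `α` in the set `X₀` of global states, is a probabilistic two-components process:
each `P α` is a probability measure on `Ω`, and every global state that is reachable with respect
to some `P α`, `α ∈ X₀`, belongs to `X₀`.  (The values of `P` outside `X₀` are irrelevant.) -/
structure IsTwoComponentProcess (X₀ : Set (S₁ × S₂)) (P : S₁ × S₂ → Measure (MaxTraj S₁ S₂)) :
    Prop where
  isProbabilityMeasure : ∀ α ∈ X₀, IsProbabilityMeasure (P α)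
  mem_of_reachable : ∀ α ∈ X₀, ∀ s : FinTraj S₁ S₂, 0 < P α s.cylinder → s.gamma α ∈ X₀

/-- `ν` is the probabilistic future of `s` with respect to `μ`: it is the probability measure on `Ω`
characterized by `ν(↑t) = μ(↑(s · t)) / μ(↑s)` for all finite trajectories `t`. -/
def IsProbabilisticFuture (μ : Measure (MaxTraj S₁ S₂)) (s : FinTraj S₁ S₂)
    (ν : Measure (MaxTraj S₁ S₂)) : Prop :=
  IsProbabilityMeasure ν ∧ ∀ t : FinTraj S₁ S₂, ν t.cylinder = μ (s.append t).cylinder / μ s.cylinder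

/-- Markov two-components processes. -/
structure IsMarkovTwoComponentProcess (X₀ : Set (S₁ × S₂))
    (P : S₁ × S₂ → Measure (MaxTraj S₁ S₂)) : Prop extends IsTwoComponentProcess X₀ P where
  markov : ∀ α ∈ X₀, ∀ s : FinTraj S₁ S₂, 0 < P α s.cylinder →
    IsProbabilisticFuture (P α) s (P (s.gamma α))

/-- With respect to `μ`, the components `ω¹` and `ω²` are independent conditionally on the
synchronization sequence `Y`: `E(φ₁ φ₂ | ⟨Y⟩) = E(φ₁ | ⟨Y⟩) E(φ₂ | ⟨Y⟩)` for all nonnegative bounded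
variables `φ₁`, `φ₂` measurable with respect to `ω¹` and to `ω²` respectively. -/
def CondIndepComponents (μ : Measure (MaxTraj S₁ S₂)) : Prop :=
  ∀ φ₁ φ₂ : MaxTraj S₁ S₂ → ℝ,
    Measurable[MeasurableSpace.comap (fun ω : MaxTraj S₁ S₂ => ω.1.1) MeasurableSpace.pi] φ₁ →
    Measurable[MeasurableSpace.comap (fun ω : MaxTraj S₁ S₂ => ω.1.2) MeasurableSpace.pi] φ₂ →
    (∀ ω, 0 ≤ φ₁ ω) → (∀ ω, 0 ≤ φ₂ ω) → (∃ C, ∀ ω, φ₁ ω ≤ C) → (∃ C, ∀ ω, φ₂ ω ≤ C) →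
    μ[fun ω => φ₁ ω * φ₂ ω | syncSigma] =ᵐ[μ]
      fun ω => (μ[φ₁ | syncSigma]) ω * (μ[φ₂ | syncSigma]) ω

/-- The Local Independence Property: `P` is a Markov two-components process, and `ω¹` and `ω²` are
independent conditionally on the synchronization sequence `Y` with respect to each `P α`. -/
structure LocalIndependenceProperty (X₀ : Set (S₁ × S₂))
    (P : S₁ × S₂ → Measure (MaxTraj S₁ S₂)) : Prop extends IsMarkovTwoComponentProcess X₀ P where
  condIndep : ∀ α ∈ X₀, CondIndepComponents (P α)

end Processes

section Chains

/-- The law, on the space of sequences `(X_0, X_1, …)`, of the homogeneous Markov chain with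
initial law `μ₀` and transition kernel `K`. -/
def chainLaw {E : Type*} [MeasurableSpace E] (μ₀ : Measure E) (K : Kernel E E) [IsMarkovKernel K] :
    Measure (ℕ → E) :=
  Kernel.trajMeasure (X := fun _ => E) μ₀
    (fun n => K.comap (fun h : (i : Finset.Iic n) → E => h ⟨n, Finset.mem_Iic.2 le_rfl⟩)
      (measurable_pi_apply _))

instance {E : Type*} [MeasurableSpace E] (μ₀ : Measure E) [IsProbabilityMeasure μ₀]
    (K : Kernel E E) [IsMarkovKernel K] : IsProbabilityMeasure (chainLaw μ₀ K) := by
  unfold chainLaw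
  infer_instance

/-- A stochastic matrix with positive coefficients. -/
structure PosTransitionMatrix {A : Type*} [DecidableEq A] (S : Finset A) where
  mat : Matrix S S ℝ
  stochastic : mat ∈ Matrix.rowStochastic ℝ S
  pos : ∀ x y, 0 < mat x y

variable {A : Type*} [DecidableEq A] {S : Finset A}

/-- The transition kernel `x ↦ ∑ y, M(x, y) δ_y` of a transition matrix. -/
def PosTransitionMatrix.kernel (M : PosTransitionMatrix S) : Kernel S S :=
  Kernel.ofFunOfCountable fun x => ∑ y : S, ENNReal.ofReal (M.mat x y) • Measure.dirac y

lemma PosTransitionMatrix.kernel_apply (M : PosTransitionMatrix S) (x : S) :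
    M.kernel x = ∑ y : S, ENNReal.ofReal (M.mat x y) • Measure.dirac y := rfl

instance (M : PosTransitionMatrix S) : IsMarkovKernel M.kernel := by
  refine ⟨fun x => ⟨?_⟩⟩
  rw [M.kernel_apply, Measure.coe_finsetSum, Finset.sum_apply]
  simp only [Measure.smul_apply, measure_univ, smul_eq_mul, mul_one]
  rw [← ENNReal.ofReal_sum_of_nonneg fun y _ => (M.pos x y).le,
    Matrix.sum_row_of_mem_rowStochastic M.stochastic, ENNReal.ofReal_one]

/-- The law `M_x` of the Markov chain `(X_0, X_1, …)` with transition matrix `M` and `X_0 = x`. -/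
def PosTransitionMatrix.law (M : PosTransitionMatrix S) (x : S) : Measure (ℕ → S) :=
  chainLaw (Measure.dirac x) M.kernel

instance (M : PosTransitionMatrix S) (x : S) : IsProbabilityMeasure (M.law x) := by
  unfold PosTransitionMatrix.law
  infer_instance

lemma PosTransitionMatrix.law_one_pos (M : PosTransitionMatrix S) (x y : S) :
    0 < M.law x {ω | ω 1 = y} := by
  have hm : Measurable fun ω : ℕ → S => ω 1 := measurable_pi_apply _
  have hset : {ω : ℕ → S | ω 1 = y} = (fun ω : ℕ → S => ω 1) ⁻¹' {y} := rfl
  rw [hset, ← Measure.map_apply hm (MeasurableSet.of_discrete), PosTransitionMatrix.law, chainLaw,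
    Kernel.trajMeasure, Measure.map_dirac' (MeasurableEquiv.measurable _), Measure.dirac_bind (Kernel.measurable _),
    ← Kernel.map_apply _ hm, Kernel.map_traj_succ_self (X := fun _ => S) (a := 0),
    Kernel.comap_apply, M.kernel_apply, Measure.coe_finsetSum, Finset.sum_apply]
  refine lt_of_lt_of_le ?_ (Finset.single_le_sum (fun _ _ => zero_le) (Finset.mem_univ y))
  simp [M.pos]

end Chains

section Product

variable {A : Type*} [DecidableEq A] {S₁ S₂ : Finset A}

/-- The sequence `x = (x_0, x_1, …)` meets `Q` at some positive time. -/
def Hits (Q : Finset A) {S : Finset A} (x : ℕ → S) : Prop := ∃ n, 0 < n ∧ (x n : A) ∈ Q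

/-- The first hitting time `τ = inf {n > 0 | x_n ∈ Q}`, for a sequence that meets `Q` at some
positive time. -/
def hitTime (Q : Finset A) {S : Finset A} (x : ℕ → S) : ℕ := sInf {n | 0 < n ∧ (x n : A) ∈ Q}

variable (S₁ S₂) in
/-- The event `Δ`: both hitting times of `Q` are finite, and the two chains meet `Q` in the same
state. -/
def meetSet : Set ((ℕ → S₁) × (ℕ → S₂)) :=
  {x | Hits (S₁ ∩ S₂) x.1 ∧ Hits (S₁ ∩ S₂) x.2 ∧
    (x.1 (hitTime (S₁ ∩ S₂) x.1) : A) = x.2 (hitTime (S₁ ∩ S₂) x.2)}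

/-- The finite sequence `x_1 x_2 ⋯ x_τ`. -/
def firstBlock (Q : Finset A) {S : Finset A} (x : ℕ → S) : List S :=
  seqTake (fun n => x (n + 1)) (hitTime Q x)

lemma firstBlock_spec (Q : Finset A) {S : Finset A} (x : ℕ → S) (hx : Hits Q x) :
    listInduced Q (firstBlock Q x) = [(x (hitTime Q x) : A)] ∧
      (firstBlock Q x).getLast? = some (x (hitTime Q x)) := by
  have hmem : 0 < hitTime Q x ∧ (x (hitTime Q x) : A) ∈ Q :=
    Nat.sInf_mem (s := {n | 0 < n ∧ (x n : A) ∈ Q}) hx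
  obtain ⟨t, ht⟩ := Nat.exists_eq_succ_of_ne_zero hmem.1.ne'
  have hmin : ∀ n, n < t → (x (n + 1) : A) ∉ Q := by
    intro n hn hQ
    have : hitTime Q x ≤ n + 1 := Nat.sInf_le ⟨Nat.succ_pos n, hQ⟩
    omega
  have hnil : listInduced Q (seqTake (fun n => x (n + 1)) t) = [] := by
    simp only [listInduced, seqTake, List.map_map, List.filter_eq_nil_iff, List.mem_map,
      List.mem_range, Function.comp_apply, decide_eq_true_eq]
    rintro a ⟨n, hn, rfl⟩
    exact hmin n hn
  have hQ := hmem.2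
  unfold firstBlock
  rw [ht] at hQ ⊢
  rw [Nat.succ_eq_add_one, seqTake_succ]
  refine ⟨?_, by simp⟩
  rw [listInduced_append, hnil]
  simpa [listInduced] using hQ

/-- The random elementary trajectory `σ_0 = (X¹_1 ⋯ X¹_{τ¹}, X²_1 ⋯ X²_{τ²})`, defined on `Δ`. -/
def firstElem (x : meetSet S₁ S₂) : Elem S₁ S₂ :=
  ⟨⟨(firstBlock (S₁ ∩ S₂) x.1.1, firstBlock (S₁ ∩ S₂) x.1.2), by
      simp only [(firstBlock_spec _ _ x.2.1).1, (firstBlock_spec _ _ x.2.2.1).1, x.2.2.2]⟩,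
    ⟨(x.1.1 (hitTime (S₁ ∩ S₂) x.1.1) : A), (firstBlock_spec _ _ x.2.1).1,
      by simp only [(firstBlock_spec _ _ x.2.1).2, Option.map_some],
      by simp only [(firstBlock_spec _ _ x.2.2.1).2, Option.map_some, x.2.2.2]⟩⟩

/-- The law `U_α` on elementary trajectories: the law of `σ_0` under the conditional probability
`M¹_x ⊗ M²_z (· | Δ)`, where `α = (x, z)`. -/
def elemLaw (M₁ : PosTransitionMatrix S₁) (M₂ : PosTransitionMatrix S₂) (α : S₁ × S₂) :
    Measure (Elem S₁ S₂) :=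
  ((((M₁.law α.1).prod (M₂.law α.2))[|meetSet S₁ S₂]).comap
    (Subtype.val : meetSet S₁ S₂ → (ℕ → S₁) × (ℕ → S₂))).map firstElem

lemma measurableSet_hits {A : Type*} (Q : Finset A) {S : Finset A} :
    MeasurableSet {x : ℕ → S | Hits Q x} := by
  simp only [Hits, Set.ofPred_exists, Set.ofPred_and]
  exact MeasurableSet.iUnion fun n => (MeasurableSet.const _).inter (measurableSet_mem Q n)

lemma measurable_hitTime {A : Type*} (Q : Finset A) {S : Finset A} :
    Measurable (fun x : ℕ → S => hitTime Q x) := by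
  refine measurable_to_nat fun x => ?_
  generalize hitTime Q x = n
  have h : (fun x : ℕ → S => hitTime Q x) ⁻¹' {n} =
      ({x | Hits Q x} ∩ ({x | 0 < n ∧ (x n : A) ∈ Q} ∩ {x | ∀ m < n, ¬ (0 < m ∧ (x m : A) ∈ Q)})) ∪
        ({x | Hits Q x}ᶜ ∩ {_x | n = 0}) := by
    ext x
    by_cases hx : Hits Q x
    · have hs : 0 < hitTime Q x ∧ (x (hitTime Q x) : A) ∈ Q :=
        Nat.sInf_mem (s := {n | 0 < n ∧ (x n : A) ∈ Q}) hx
      simp only [Set.mem_preimage, Set.mem_singleton_iff, Set.mem_union, Set.mem_inter_iff,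
        Set.mem_ofPred_eq, hx, true_and, Set.mem_compl_iff, not_true, false_and, or_false]
      constructor
      · rintro rfl
        exact ⟨hs, fun m hm h => absurd (Nat.sInf_le h : hitTime Q x ≤ m) (not_le.2 hm)⟩
      · rintro ⟨h1, h2⟩
        refine le_antisymm (Nat.sInf_le h1) (not_lt.1 fun hlt => h2 _ hlt hs)
    · have h0 : hitTime Q x = 0 := by
        have : {n | 0 < n ∧ (x n : A) ∈ Q} = ∅ := Set.eq_empty_iff_forall_notMem.2 fun n hn => hx ⟨n, hn⟩
        simp [hitTime, this]
      simp [hx, h0, eq_comm]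
  rw [h]
  refine ((measurableSet_hits Q).inter (((MeasurableSet.const _).inter
    (measurableSet_mem Q n)).inter ?_)).union ((measurableSet_hits Q).compl.inter
      (MeasurableSet.const _))
  simp only [Set.ofPred_forall]
  exact MeasurableSet.iInter fun m => MeasurableSet.iInter fun _ =>
    ((MeasurableSet.const _).inter (measurableSet_mem Q m)).compl

lemma measurable_hitState {A : Type*} (Q : Finset A) {S : Finset A} :
    Measurable (fun x : ℕ → S => x (hitTime Q x)) := by
  refine measurable_to_countable' fun a => ?_
  have h : (fun x : ℕ → S => x (hitTime Q x)) ⁻¹' {a} =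
      ⋃ n, ((fun x : ℕ → S => hitTime Q x) ⁻¹' {n} ∩ (fun x : ℕ → S => x n) ⁻¹' {a}) := by
    ext x
    simp
  rw [h]
  exact MeasurableSet.iUnion fun n => (measurable_hitTime Q MeasurableSet.of_discrete).inter
    (measurable_pi_apply n MeasurableSet.of_discrete)

lemma measurableSet_meetSet : MeasurableSet (meetSet S₁ S₂) := by
  refine (measurable_fst (measurableSet_hits _)).inter
    ((measurable_snd (measurableSet_hits _)).inter ?_)
  exact (((measurable_hitState (S₁ ∩ S₂)).comp measurable_fst).prodMk
    ((measurable_hitState (S₁ ∩ S₂)).comp measurable_snd))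
    (MeasurableSet.of_discrete (s := {a : S₁ × S₂ | (a.1 : A) = a.2}))

lemma measurableSet_firstBlock {A : Type*} (Q : Finset A) {S : Finset A} (l : List S) :
    MeasurableSet {x : ℕ → S | firstBlock Q x = l} := by
  have h : {x : ℕ → S | firstBlock Q x = l} = {x | hitTime Q x = l.length} ∩
      {x | ∀ i, ∀ hi : i < l.length, x (i + 1) = l[i]} := by
    ext x
    simp only [Set.mem_ofPred_eq, Set.mem_inter_iff, firstBlock, seqTake, List.ext_getElem_iff,
      List.length_map, List.length_range, List.getElem_map, List.getElem_range]
    exact ⟨fun h => ⟨h.1, fun i hi => h.2 i (h.1 ▸ hi) hi⟩, fun h => ⟨h.1, fun i _ hi => h.2 i hi⟩⟩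
  rw [h]
  refine (measurable_hitTime Q (MeasurableSet.of_discrete (s := {l.length}))).inter ?_
  simp only [Set.ofPred_forall]
  exact MeasurableSet.iInter fun i => MeasurableSet.iInter fun hi =>
    measurableSet_preimage (f := fun x : ℕ → S => x (i + 1)) (measurable_pi_apply (i + 1))
      (MeasurableSet.of_discrete (s := {l[i]}))

lemma measurable_firstElem : Measurable (firstElem : meetSet S₁ S₂ → Elem S₁ S₂) := by
  refine measurable_to_countable' fun σ => ?_
  have h : (firstElem : meetSet S₁ S₂ → Elem S₁ S₂) ⁻¹' {σ} = Subtype.val ⁻¹'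
      ((Prod.fst ⁻¹' {x | firstBlock (S₁ ∩ S₂) x = σ.1.1.1}) ∩
        (Prod.snd ⁻¹' {x | firstBlock (S₁ ∩ S₂) x = σ.1.1.2})) := by
    ext x
    simp only [Set.mem_preimage, Set.mem_singleton_iff, Set.mem_inter_iff, Set.mem_ofPred_eq]
    constructor
    · rintro rfl
      exact ⟨rfl, rfl⟩
    · rintro ⟨h1, h2⟩
      exact Subtype.ext (Subtype.ext (Prod.ext h1 h2))
  rw [h]
  exact measurable_subtype_coe ((measurable_fst (measurableSet_firstBlock _ _)).inter
    (measurable_snd (measurableSet_firstBlock _ _)))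

lemma meetSet_pos (hQ : (S₁ ∩ S₂).Nonempty) (M₁ : PosTransitionMatrix S₁)
    (M₂ : PosTransitionMatrix S₂) (α : S₁ × S₂) :
    0 < (M₁.law α.1).prod (M₂.law α.2) (meetSet S₁ S₂) := by
  obtain ⟨q, hq⟩ := hQ
  have hq1 := (Finset.mem_inter.1 hq).1
  have hq2 := (Finset.mem_inter.1 hq).2
  have key : ∀ {S : Finset A} (x : ℕ → S), (x 1 : A) = q →
      Hits (S₁ ∩ S₂) x ∧ (x (hitTime (S₁ ∩ S₂) x) : A) = q := by
    intro S x hx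
    have h1 : 0 < 1 ∧ (x 1 : A) ∈ S₁ ∩ S₂ := ⟨one_pos, hx ▸ hq⟩
    have hs : 0 < hitTime (S₁ ∩ S₂) x ∧ (x (hitTime (S₁ ∩ S₂) x) : A) ∈ S₁ ∩ S₂ :=
      Nat.sInf_mem (s := {n | 0 < n ∧ (x n : A) ∈ S₁ ∩ S₂}) ⟨1, h1⟩
    have hle : hitTime (S₁ ∩ S₂) x ≤ 1 := Nat.sInf_le h1
    have : hitTime (S₁ ∩ S₂) x = 1 := le_antisymm hle hs.1
    exact ⟨⟨1, h1⟩, by rw [this, hx]⟩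
  have hsub : {x : ℕ → S₁ | x 1 = ⟨q, hq1⟩} ×ˢ {x : ℕ → S₂ | x 1 = ⟨q, hq2⟩} ⊆ meetSet S₁ S₂ := by
    rintro ⟨x, y⟩ ⟨hx, hy⟩
    have kx := key x (congrArg Subtype.val hx)
    have ky := key y (congrArg Subtype.val hy)
    exact ⟨kx.1, ky.1, kx.2.trans ky.2.symm⟩
  refine lt_of_lt_of_le ?_ (measure_mono hsub)
  rw [Measure.prod_prod]
  exact ENNReal.mul_pos (M₁.law_one_pos _ _).ne' (M₂.law_one_pos _ _).ne'

lemma isProbabilityMeasure_elemLaw (hQ : (S₁ ∩ S₂).Nonempty) (M₁ : PosTransitionMatrix S₁)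
    (M₂ : PosTransitionMatrix S₂) (α : S₁ × S₂) : IsProbabilityMeasure (elemLaw M₁ M₂ α) := by
  have h0 := (meetSet_pos hQ M₁ M₂ α).ne'
  refine ⟨?_⟩
  rw [elemLaw, Measure.map_apply measurable_firstElem MeasurableSet.univ, Set.preimage_univ,
    comap_subtype_coe_apply measurableSet_meetSet, Set.image_univ, Subtype.range_coe]
  exact cond_apply_self h0 (measure_ne_top _ _)

/-- The transition kernel `K(σ, ·) = U_{γ(σ)}` on elementary trajectories. -/
def elemKernel (M₁ : PosTransitionMatrix S₁) (M₂ : PosTransitionMatrix S₂) :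
    Kernel (Elem S₁ S₂) (Elem S₁ S₂) :=
  Kernel.ofFunOfCountable fun σ => elemLaw M₁ M₂ σ.gamma

lemma Elem.shared_nonempty (σ : Elem S₁ S₂) : (S₁ ∩ S₂).Nonempty := by
  obtain ⟨q, h, -, -⟩ := σ.2
  have : q ∈ listInduced (S₁ ∩ S₂) σ.1.1.1 := by rw [h]; simp
  exact ⟨q, by simpa using (List.mem_filter.1 this).2⟩

instance (M₁ : PosTransitionMatrix S₁) (M₂ : PosTransitionMatrix S₂) :
    IsMarkovKernel (elemKernel M₁ M₂) :=
  ⟨fun σ => isProbabilityMeasure_elemLaw σ.shared_nonempty M₁ M₂ σ.gamma⟩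

variable (S₁ S₂) in
/-- The set `X₀ = {(x, z) | x ∈ Q ∧ z ∈ Q ⇒ x = z}` of initial global states. -/
def syncStates : Set (S₁ × S₂) :=
  {α | (α.1 : A) ∈ S₁ ∩ S₂ ∧ (α.2 : A) ∈ S₁ ∩ S₂ → (α.1 : A) = α.2}

/-- The synchronization product of two Markov chains: `P_α` is the law of the infinite
concatenation `σ_0 · σ_1 · σ_2 ⋯`, where `(σ_n)` is the Markov chain on elementary trajectories with
initial law `U_α` and transition kernel `K`.  It is considered for `α ∈ X₀`. -/
def syncProduct (M₁ : PosTransitionMatrix S₁) (M₂ : PosTransitionMatrix S₂) (α : S₁ × S₂) :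
    Measure (MaxTraj S₁ S₂) :=
  (chainLaw (elemLaw M₁ M₂ α) (elemKernel M₁ M₂)).map concat

end Product

end TwoSite

end

/-! Everything rests on two facts about the first elementary trajectory. The renewal equation
`syncProduct_apply` says that P_α is the mixture over σ, with weights U_α(σ), of "σ followed by a
path of law P_γ(σ)". The weight formula `elemLaw_singleton` says that U_α(σ) is a normalizing
constant 1/M(Δ), depending only on α, times the product of the path weights of the two components of
σ. Combinatorially, local words with a single element of Q, placed at the end ("blocks"), form a
prefix-free code, and an elementary trajectory is just a pair of blocks with the same end q.

Markov property. It suffices that P_α(↑(s·t)) = c · P_γ(↑t) with γ = γ_α(s) and c independent of t: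
the empty t then identifies c as P_α(↑s). Cut s into elementary trajectories and a remainder r
without synchronization. An elementary trajectory is peeled off by the renewal equation, in which
prefix-freeness leaves one term. For r, the trajectories compatible with it are exactly the r·ρ with
ρ elementary, and U_α(r·ρ) is proportional to U_γ(ρ) because path weights are multiplicative;
positivity of the meeting probability allows the normalization to be changed.

Local independence. Fix the first n terms of Y. Elementary trajectories ending at q are arbitrary
pairs of blocks ending at q, their weights are products, and the next global state is (q,q) whatever
the blocks were. By induction the law of the first n blocks of the two components therefore
factorizes on this event (`exists_syncProduct_syncEvent_eq_mul`). A prefix cylinder depends on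
finitely many blocks, so two cylinders, one on each site, are conditionally independent given Y_0,
…, Y_{n-1} for all large n. Lévy's upward theorem passes to the whole of Y, a π-system argument to
all events, and regular conditional laws to bounded functions. -/

noncomputable section

namespace TwoSite

/-! ### Words, prefixes and cylinders of infinite sequences -/

section SeqAppend

variable {E : Type*}

/-- The infinite sequence `a, x 0, x 1, …`. -/
def seqCons (a : E) (x : ℕ → E) : ℕ → E
  | 0 => a
  | n + 1 => x n

@[simp] lemma seqCons_zero (a : E) (x : ℕ → E) : seqCons a x 0 = a := rfl

@[simp] lemma seqCons_succ (a : E) (x : ℕ → E) (n : ℕ) : seqCons a x (n + 1) = x n := rfl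

/-- The concatenation of a finite sequence and an infinite sequence. -/
def seqAppend : List E → (ℕ → E) → ℕ → E
  | [], x => x
  | a :: l, x => seqCons a (seqAppend l x)

@[simp] lemma seqAppend_nil (x : ℕ → E) : seqAppend [] x = x := rfl

@[simp] lemma seqAppend_cons (a : E) (l : List E) (x : ℕ → E) :
    seqAppend (a :: l) x = seqCons a (seqAppend l x) := rfl

lemma seqAppend_append (l m : List E) (x : ℕ → E) :
    seqAppend (l ++ m) x = seqAppend l (seqAppend m x) := by
  induction l with
  | nil => rfl
  | cons a l ih => simp [ih]

lemma IsSeqPrefix.nil (x : ℕ → E) : IsSeqPrefix [] x := rfl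

lemma setOf_isSeqPrefix_nil : {x : ℕ → E | IsSeqPrefix [] x} = Set.univ :=
  Set.eq_univ_of_forall fun x => IsSeqPrefix.nil x

lemma isSeqPrefix_iff_getElem {l : List E} {x : ℕ → E} :
    IsSeqPrefix l x ↔ ∀ i, ∀ hi : i < l.length, x i = l[i] := by
  unfold IsSeqPrefix seqTake
  rw [List.ext_getElem_iff]
  simp

lemma isSeqPrefix_cons {a : E} {l : List E} {x : ℕ → E} :
    IsSeqPrefix (a :: l) x ↔ x 0 = a ∧ IsSeqPrefix l (fun n => x (n + 1)) := by
  simp only [isSeqPrefix_iff_getElem, List.length_cons]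
  constructor
  · exact fun h => ⟨h 0 (by simp), fun i hi => by
      have := h (i + 1) (by omega)
      rwa [List.getElem_cons_succ] at this⟩
  · rintro ⟨h0, h⟩ (_ | i) hi
    · simpa using h0
    · simpa using h i (by omega)

@[simp] lemma isSeqPrefix_cons_seqCons {a b : E} {l : List E} {x : ℕ → E} :
    IsSeqPrefix (a :: l) (seqCons b x) ↔ b = a ∧ IsSeqPrefix l x := isSeqPrefix_cons

@[simp] lemma isSeqPrefix_append_seqAppend {b l : List E} {x : ℕ → E} :
    IsSeqPrefix (b ++ l) (seqAppend b x) ↔ IsSeqPrefix l x := by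
  induction b with
  | nil => rfl
  | cons a b ih => simpa using ih

lemma isSeqPrefix_seqAppend (b : List E) (x : ℕ → E) : IsSeqPrefix b (seqAppend b x) := by
  have := isSeqPrefix_append_seqAppend (b := b) (l := []) (x := x)
  rw [List.append_nil] at this
  exact this.2 (IsSeqPrefix.nil x)

lemma isSeqPrefix_append {b l : List E} {x : ℕ → E} :
    IsSeqPrefix (b ++ l) x ↔ IsSeqPrefix b x ∧ IsSeqPrefix l (fun n => x (n + b.length)) := by
  induction b generalizing x with
  | nil => simp [IsSeqPrefix.nil]
  | cons a b ih =>
    rw [List.cons_append, isSeqPrefix_cons, ih, isSeqPrefix_cons, and_assoc]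
    simp only [List.length_cons, add_assoc]

lemma IsSeqPrefix.of_prefix {l m : List E} {x : ℕ → E} (hm : IsSeqPrefix m x) (h : l <+: m) :
    IsSeqPrefix l x := by
  obtain ⟨c, rfl⟩ := h
  exact (isSeqPrefix_append.1 hm).1

lemma IsSeqPrefix.prefix_of_length_le {l m : List E} {x : ℕ → E} (hl : IsSeqPrefix l x)
    (hm : IsSeqPrefix m x) (h : l.length ≤ m.length) : l <+: m := by
  rw [isSeqPrefix_iff_getElem] at hl hm
  rw [List.prefix_iff_getElem]
  exact ⟨h, fun i hi => by rw [← hl i hi, ← hm i (hi.trans_le h)]⟩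

lemma IsSeqPrefix.prefix_or_prefix {l m : List E} {x : ℕ → E} (hl : IsSeqPrefix l x)
    (hm : IsSeqPrefix m x) : l <+: m ∨ m <+: l :=
  (le_total l.length m.length).imp (fun h => hl.prefix_of_length_le hm h)
    fun h => hm.prefix_of_length_le hl h

lemma length_flatten_map_range_ge (L : ℕ → List E) (hL : ∀ k, L k ≠ []) (m : ℕ) :
    m ≤ (((List.range m).map L).flatten).length := by
  induction m with
  | zero => simp
  | succ m ih =>
    have := List.length_pos_iff.2 (hL m)
    simp only [List.range_succ, List.map_append, List.map_cons, List.map_nil,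
      List.flatten_append, List.flatten_cons, List.flatten_nil, List.append_nil,
      List.length_append]
    omega

/-- Both sides have the first `n + 1` words as a prefix, and since the words are nonempty this
prefix reaches beyond index `n`. -/
lemma seqConcat_eq_seqAppend (L L' : ℕ → List E) (hL : ∀ k, L k ≠ []) (hL' : ∀ k, L' k ≠ [])
    (h : ∀ k, L (k + 1) = L' k) : seqConcat L hL = seqAppend (L 0) (seqConcat L' hL') := by
  funext n
  have h1 : IsSeqPrefix (((List.range (n + 1)).map L).flatten) (seqConcat L hL) :=
    seqTake_seqConcat L hL (n + 1)
  have h2 : IsSeqPrefix (((List.range (n + 1)).map L).flatten)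
      (seqAppend (L 0) (seqConcat L' hL')) := by
    have e : ((List.range (n + 1)).map L).flatten = L 0 ++ ((List.range n).map L').flatten := by
      rw [List.range_succ_eq_map, List.map_cons, List.flatten_cons, List.map_map]
      congr 3
      funext k
      exact h k
    rw [e, isSeqPrefix_append_seqAppend]
    exact seqTake_seqConcat L' hL' n
  have hn := length_flatten_map_range_ge L hL (n + 1)
  rw [isSeqPrefix_iff_getElem] at h1 h2
  rw [h1 n (by omega), h2 n (by omega)]

/-- Two prefixes of one sequence are comparable, so cylinders that meet are nested. -/
lemma isPiSystem_isSeqPrefix :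
    IsPiSystem (Set.range fun l : List E => {x : ℕ → E | IsSeqPrefix l x}) := by
  rintro _ ⟨l, rfl⟩ _ ⟨m, rfl⟩ ⟨x, hl, hm⟩
  rcases IsSeqPrefix.prefix_or_prefix hl hm with h | h
  · refine ⟨m, Set.ext fun y => ⟨fun hy => ⟨IsSeqPrefix.of_prefix hy h, hy⟩, fun hy => hy.2⟩⟩
  · refine ⟨l, Set.ext fun y => ⟨fun hy => ⟨hy, IsSeqPrefix.of_prefix hy h⟩, fun hy => hy.1⟩⟩

variable [MeasurableSpace E]

lemma measurable_seqCons (a : E) : Measurable (seqCons a) := by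
  refine measurable_pi_lambda _ fun n => ?_
  cases n with
  | zero => exact measurable_const
  | succ n => exact measurable_pi_apply n

lemma measurable_seqAppend (l : List E) : Measurable (seqAppend l) := by
  induction l with
  | nil => exact measurable_id
  | cons a l ih => exact (measurable_seqCons a).comp ih

lemma measurableSet_isSeqPrefix [DiscreteMeasurableSpace E] (l : List E) :
    MeasurableSet {x : ℕ → E | IsSeqPrefix l x} := by
  simp only [isSeqPrefix_iff_getElem, Set.ofPred_forall]
  exact MeasurableSet.iInter fun i => MeasurableSet.iInter fun hi =>
    measurableSet_preimage (f := fun x : ℕ → E => x i) (measurable_pi_apply i)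
      (MeasurableSet.of_discrete (s := {l[i]}))

/-- There are countably many words, so an event on the coordinate `n` is a countable union of
cylinders of length greater than `n`. -/
lemma generateFrom_isSeqPrefix [Countable E] [DiscreteMeasurableSpace E] :
    MeasurableSpace.generateFrom (Set.range fun l : List E => {x : ℕ → E | IsSeqPrefix l x}) =
      MeasurableSpace.pi := by
  apply le_antisymm
  · refine MeasurableSpace.generateFrom_le ?_
    rintro _ ⟨l, rfl⟩
    exact measurableSet_isSeqPrefix l
  · refine iSup_le fun n => ?_
    rintro _ ⟨U, -, rfl⟩
    have h : (fun x : ℕ → E => x n) ⁻¹' U =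
        ⋃ l ∈ {l : List E | ∃ h : n < l.length, l[n] ∈ U}, {x : ℕ → E | IsSeqPrefix l x} := by
      ext x
      simp only [Set.mem_preimage, Set.mem_ofPred_eq, Set.mem_iUnion, exists_prop]
      constructor
      · intro hx
        have hp : IsSeqPrefix (seqTake x (n + 1)) x := by simp [IsSeqPrefix, seqTake]
        exact ⟨seqTake x (n + 1), ⟨by simp [seqTake], by simpa [seqTake] using hx⟩, hp⟩
      · rintro ⟨l, ⟨hn, hU⟩, hl⟩
        rwa [isSeqPrefix_iff_getElem.1 hl n hn]
    rw [h]
    exact MeasurableSet.biUnion (Set.to_countable _) fun l _ =>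
      MeasurableSpace.measurableSet_generateFrom ⟨l, rfl⟩

end SeqAppend

/-! ### Induced Q-sequences and blocks -/

section Induced

variable {A : Type*} [DecidableEq A] (Q : Finset A) {S : Finset A}

/-- Trades `Nat.nth` for an explicit index, which simply shifts by one when a letter is put in
front. -/
lemma seqInduced_eq_some_iff {x : ℕ → S} {n : ℕ} {a : A} :
    seqInduced Q x n = some a ↔
      ∃ k, (x k : A) ∈ Q ∧ Nat.count (fun j => (x j : A) ∈ Q) k = n ∧ (x k : A) = a := by
  unfold seqInduced
  constructor
  · intro h
    split_ifs at h with h0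
    obtain ⟨k, hk, rfl⟩ := h0
    rw [Nat.nth_count (p := fun j => (x j : A) ∈ Q) hk] at h
    exact ⟨k, hk, rfl, Option.some_injective _ h⟩
  · rintro ⟨k, hk, rfl, rfl⟩
    rw [if_pos ⟨k, hk, rfl⟩, Nat.nth_count (p := fun j => (x j : A) ∈ Q) hk]

lemma count_seqCons (a : S) (x : ℕ → S) (k : ℕ) :
    Nat.count (fun j => ((seqCons a x j : S) : A) ∈ Q) (k + 1) =
      Nat.count (fun j => (x j : A) ∈ Q) k + if (a : A) ∈ Q then 1 else 0 := by
  rw [Nat.count_succ']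
  rfl

lemma seqInduced_seqCons_of_notMem {a : S} (ha : (a : A) ∉ Q) (x : ℕ → S) :
    seqInduced Q (seqCons a x) = seqInduced Q x := by
  funext n
  refine Option.ext fun b => ?_
  rw [seqInduced_eq_some_iff, seqInduced_eq_some_iff]
  constructor
  · rintro ⟨_ | k, hk, hc, hb⟩
    · exact absurd hk ha
    · exact ⟨k, hk, by simpa [count_seqCons, ha] using hc, hb⟩
  · rintro ⟨k, hk, hc, hb⟩
    exact ⟨k + 1, hk, by simpa [count_seqCons, ha] using hc, hb⟩

lemma seqInduced_seqCons_of_mem {a : S} (ha : (a : A) ∈ Q) (x : ℕ → S) :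
    seqInduced Q (seqCons a x) = seqCons (some (a : A)) (seqInduced Q x) := by
  funext n
  refine Option.ext fun b => ?_
  rw [seqInduced_eq_some_iff]
  cases n with
  | zero =>
    rw [seqCons_zero, Option.some_inj]
    constructor
    · rintro ⟨_ | k, hk, hc, hb⟩
      · exact hb
      · simp [count_seqCons, ha] at hc
    · exact fun h => ⟨0, ha, by simp, h⟩
  | succ n =>
    rw [seqCons_succ, seqInduced_eq_some_iff]
    constructor
    · rintro ⟨_ | k, hk, hc, hb⟩
      · simp at hc
      · exact ⟨k, hk, by simpa [count_seqCons, ha] using hc, hb⟩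
    · rintro ⟨k, hk, hc, hb⟩
      exact ⟨k + 1, hk, by simpa [count_seqCons, ha] using hc, hb⟩

/-- Used twice: a finite trajectory followed by a maximal one still synchronizes, and an elementary
trajectory put in front shifts Y by one term. -/
lemma seqInduced_seqAppend (b : List S) (x : ℕ → S) :
    seqInduced Q (seqAppend b x) = seqAppend ((listInduced Q b).map some) (seqInduced Q x) := by
  induction b with
  | nil => rfl
  | cons a b ih =>
    by_cases ha : (a : A) ∈ Q
    · rw [seqAppend_cons, seqInduced_seqCons_of_mem Q ha, ih]
      simp [listInduced, ha]
    · rw [seqAppend_cons, seqInduced_seqCons_of_notMem Q ha, ih]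
      simp [listInduced, ha]

/-- A block with end `q` is a finite sequence with a unique element in `Q`, which is its last
element `q`. -/
def IsBlock (q : A) (b : List S) : Prop :=
  listInduced Q b = [q] ∧ b.getLast?.map (fun a : S => (a : A)) = some q

variable {Q}

lemma IsBlock.ne_nil {q : A} {b : List S} (h : IsBlock Q q b) : b ≠ [] := by
  rintro rfl
  simp [IsBlock] at h

lemma IsBlock.mem {q : A} {b : List S} (h : IsBlock Q q b) : q ∈ Q := by
  have : q ∈ listInduced Q b := by rw [h.1]; simp
  simpa using (List.mem_filter.1 this).2

lemma IsBlock.getLastD {q : A} {b : List S} (h : IsBlock Q q b) (x : S) :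
    (b.getLastD x : A) = q := by
  have h2 := h.2
  rw [List.getLast?_eq_getLast_of_ne_nil h.ne_nil, Option.map_some, Option.some_inj] at h2
  rw [List.getLastD_eq_getLast?, List.getLast?_eq_getLast_of_ne_nil h.ne_nil, Option.getD_some, h2]

/-- Applied to a remainder `r` without synchronization: the blocks that extend `r` are exactly `r`
followed by a block. -/
lemma isBlock_append_iff {q : A} {r b : List S} (hr : listInduced Q r = []) :
    IsBlock Q q (r ++ b) ↔ IsBlock Q q b := by
  by_cases hb : b = []
  · subst hb
    rw [List.append_nil]
    refine ⟨fun h => ?_, fun h => absurd rfl h.ne_nil⟩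
    have := h.1
    rw [hr] at this
    simp at this
  · simp only [IsBlock, listInduced_append, hr, List.nil_append, List.getLast?_append,
      List.getLast?_eq_getLast_of_ne_nil hb, Option.some_or]

/-- Blocks form a prefix-free code: a nonempty surplus of `b'` over `b` would contain the last
letter of `b'`, a second element of Q in `b'`. -/
lemma IsBlock.eq_of_prefix {q q' : A} {b b' : List S} (h : IsBlock Q q b) (h' : IsBlock Q q' b')
    (hp : b <+: b') : b = b' := by
  obtain ⟨c, rfl⟩ := hp
  have h1 := h'.1
  rw [listInduced_append, h.1, List.singleton_append, List.cons.injEq] at h1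
  by_contra hc
  have hc : c ≠ [] := fun h0 => hc (by simp [h0])
  have h2 := h'.2
  rw [List.getLast?_append, List.getLast?_eq_getLast_of_ne_nil hc, Option.some_or, Option.map_some,
    Option.some_inj] at h2
  have h3 : (c.getLast hc : A) ∈ listInduced Q c := by
    refine List.mem_filter.2 ⟨List.mem_map_of_mem (List.getLast_mem hc), ?_⟩
    rw [h2]
    exact decide_eq_true h'.mem
  rw [h1.2] at h3
  simp at h3

/-- Cut the word just after its first element of Q. -/
lemma exists_isBlock_append {q : A} {qs : List A} {l : List S} (h : listInduced Q l = q :: qs) :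
    ∃ b m, l = b ++ m ∧ IsBlock Q q b ∧ listInduced Q m = qs := by
  induction l with
  | nil => simp [listInduced] at h
  | cons a l ih =>
    by_cases ha : (a : A) ∈ Q
    · have h' : (a : A) :: listInduced Q l = q :: qs := by simpa [listInduced, ha] using h
      rw [List.cons.injEq] at h'
      obtain ⟨rfl, h'⟩ := h'
      exact ⟨[a], l, rfl, ⟨by simp [listInduced, ha], by simp⟩, h'⟩
    · have h' : listInduced Q l = q :: qs := by simpa [listInduced, ha] using h
      obtain ⟨b, m, rfl, hb, hm⟩ := ih h'
      refine ⟨a :: b, m, rfl, ?_, hm⟩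
      have : listInduced Q [a] = [] := by simp [listInduced, ha]
      exact (isBlock_append_iff (r := [a]) this).2 hb

lemma getLast?_listInduced_of_mem {l : List S} (hl : l ≠ []) (h : (l.getLast hl : A) ∈ Q) :
    (listInduced Q l).getLast? = some (l.getLast hl : A) := by
  conv_lhs => rw [← List.dropLast_append_getLast hl]
  rw [listInduced_append]
  have : listInduced Q [l.getLast hl] = [(l.getLast hl : A)] := by simp [listInduced, h]
  rw [this]
  simp

end Induced

/-! ### Path probabilities and first-step decomposition of a Markov chain -/

section ChainLaw

open scoped ENNReal

variable {E : Type*} [MeasurableSpace E]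

/-- The probability that a Markov chain with kernel `K` started at `a` goes on along the finite
sequence `l`. -/
def pathWeight (K : Kernel E E) : E → List E → ℝ≥0∞
  | _, [] => 1
  | a, b :: l => K a {b} * pathWeight K b l

lemma pathWeight_append (K : Kernel E E) (a : E) (l m : List E) :
    pathWeight K a (l ++ m) = pathWeight K a l * pathWeight K (l.getLastD a) m := by
  induction l generalizing a with
  | nil => simp [pathWeight]
  | cons b l ih =>
    have h : (b :: l).getLastD a = l.getLastD b := by
      cases l <;> rfl
    rw [List.cons_append, pathWeight, pathWeight, ih, mul_assoc, h]

lemma map_zero_chainLaw (μ₀ : Measure E) (K : Kernel E E) [IsMarkovKernel K] :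
    (chainLaw μ₀ K).map (fun x => x 0) = μ₀ := by
  have h0 : Measurable fun x : ℕ → E => x 0 := measurable_pi_apply _
  have hr : Measurable fun h : (i : Finset.Iic 0) → E => h ⟨0, Finset.mem_Iic.2 le_rfl⟩ :=
    measurable_pi_apply _
  rw [chainLaw, Kernel.trajMeasure, Measure.map_comp _ _ h0]
  have hc : (fun x : ℕ → E => x 0) =
      (fun h : (i : Finset.Iic 0) → E => h ⟨0, Finset.mem_Iic.2 le_rfl⟩) ∘
        Preorder.frestrictLe (π := fun _ => E) 0 := rfl
  rw [hc, Kernel.map_comp_right _ (Preorder.measurable_frestrictLe _) hr,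
    Kernel.traj_map_frestrictLe, Kernel.partialTraj_self]
  rw [Kernel.id_map hr, Measure.deterministic_comp_eq_map, Measure.map_map hr (MeasurableEquiv.measurable _)]
  exact Measure.map_id

variable [Countable E] [DiscreteMeasurableSpace E] (μ₀ : Measure E) [IsProbabilityMeasure μ₀]
  (K : Kernel E E) [IsMarkovKernel K]

/-- Induction from the right end of the word, because the defining property of `Kernel.trajMeasure`
is the joint law of the history up to time `n` and the next state. -/
lemma chainLaw_isSeqPrefix_cons (a : E) (l : List E) :
    chainLaw μ₀ K {x | IsSeqPrefix (a :: l) x} = μ₀ {a} * pathWeight K a l := by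
  induction l using List.reverseRecOn with
  | nil =>
    conv_rhs => rw [← map_zero_chainLaw μ₀ K]
    rw [Measure.map_apply (measurable_pi_apply _) (MeasurableSet.singleton a), pathWeight, mul_one]
    congr 1
    ext x
    simp [isSeqPrefix_cons, IsSeqPrefix.nil]
  | append_singleton l c ih =>
    let n := l.length
    -- The histories up to time `n` that read `a :: l`. The default value of `getD` is never used,
    -- since the indices are at most `n`, the length of `l`.
    let T : Set ((i : Finset.Iic n) → E) := {h | ∀ i : Finset.Iic n, h i = (a :: l).getD i a}
    have hT : MeasurableSet T := by
      simp only [T, Set.ofPred_forall]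
      exact MeasurableSet.iInter fun i =>
        measurableSet_preimage (f := fun h : (i : Finset.Iic n) → E => h i)
          (measurable_pi_apply i) (MeasurableSet.singleton ((a :: l).getD i a))
    have hpre : ∀ x : ℕ → E, Preorder.frestrictLe (π := fun _ => E) n x ∈ T ↔
        IsSeqPrefix (a :: l) x := by
      intro x
      rw [isSeqPrefix_iff_getElem]
      constructor
      · intro h i hi
        have := h ⟨i, Finset.mem_Iic.2 (by simpa [n, Nat.lt_succ_iff] using hi)⟩
        rwa [List.getD_eq_getElem _ _ hi] at this
      · rintro h ⟨i, hi⟩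
        have hi' : i < (a :: l).length := by
          have := Finset.mem_Iic.1 hi
          simp only [List.length_cons]
          omega
        rw [List.getD_eq_getElem _ _ hi']
        exact h i hi'
    have hlast : ∀ h ∈ T, h ⟨n, Finset.mem_Iic.2 le_rfl⟩ = l.getLastD a := by
      intro h hh
      rw [hh ⟨n, Finset.mem_Iic.2 le_rfl⟩]
      cases l using List.reverseRecOn with
      | nil => simp [n]
      | append_singleton l b => simp [n, List.getLastD_eq_getLast?]
    have hm := Kernel.map_frestrictLe_trajMeasure_compProd_eq_map_trajMeasure (X := fun _ => E)
      (μ₀ := μ₀) (κ := fun n => K.comap (fun h : (i : Finset.Iic n) → E =>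
        h ⟨n, Finset.mem_Iic.2 le_rfl⟩) (measurable_pi_apply _)) (a := n)
    have hm' := congrArg (fun ν => ν (T ×ˢ {c})) hm
    have hfr : Measurable (Preorder.frestrictLe (π := fun _ => E) n) :=
      Preorder.measurable_frestrictLe _
    rw [Measure.compProd_apply_prod hT (MeasurableSet.singleton c),
      Measure.map_apply (hfr.prodMk (measurable_pi_apply _)) (hT.prod (MeasurableSet.singleton c)),
      setLIntegral_congr_fun (g := fun _ => K (l.getLastD a) {c}) hT
        (fun h hh => by rw [Kernel.comap_apply, hlast h hh]),
      setLIntegral_const, Measure.map_apply hfr hT] at hm'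
    have e1 : (fun x : ℕ → E => (Preorder.frestrictLe (π := fun _ => E) n x, x (n + 1))) ⁻¹'
        (T ×ˢ {c}) = {x | IsSeqPrefix (a :: (l ++ [c])) x} := by
      ext x
      rw [Set.mem_preimage, Set.mem_prod, hpre, Set.mem_ofPred_eq, ← List.cons_append,
        isSeqPrefix_append]
      simp [isSeqPrefix_cons, IsSeqPrefix.nil, n]
    have e2 : Preorder.frestrictLe (π := fun _ => E) n ⁻¹' T = {x | IsSeqPrefix (a :: l) x} :=
      Set.ext hpre
    rw [e1, e2] at hm'
    rw [pathWeight_append, ← mul_assoc, ← ih, mul_comm]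
    simp only [pathWeight, mul_one]
    exact hm'.symm

/-- Decomposition of a Markov chain according to its first state. -/
lemma chainLaw_eq_bind : chainLaw μ₀ K =
    Measure.sum fun e => μ₀ {e} • (chainLaw (K e) K).map (seqCons e) := by
  have hone : ∑' e, μ₀ {e} = 1 := by
    have := Measure.tsum_indicator_apply_singleton μ₀ Set.univ MeasurableSet.univ
    simpa using this
  -- Both sides are compared on cylinders; for a nonempty word only the summand of its first letter
  -- survives.
  refine ext_of_generate_finite _ generateFrom_isSeqPrefix.symm isPiSystem_isSeqPrefix ?_ ?_
  · rintro _ ⟨l, rfl⟩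
    rw [Measure.sum_apply _ (measurableSet_isSeqPrefix l)]
    simp only [Measure.smul_apply, smul_eq_mul]
    cases l with
    | nil =>
      have hp : ∀ e, (chainLaw (K e) K).map (seqCons e) Set.univ = 1 := fun e => by
        rw [Measure.map_apply (measurable_seqCons e) MeasurableSet.univ, Set.preimage_univ,
          measure_univ]
      simp only [setOf_isSeqPrefix_nil, hp, mul_one, measure_univ, hone]
    | cons a l =>
      rw [chainLaw_isSeqPrefix_cons, tsum_eq_single a]
      · congr 1
        rw [Measure.map_apply (measurable_seqCons a) (measurableSet_isSeqPrefix _)]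
        cases l with
        | nil =>
          have : seqCons a ⁻¹' {x : ℕ → E | IsSeqPrefix [a] x} = Set.univ :=
            Set.eq_univ_of_forall fun x => isSeqPrefix_cons_seqCons.2 ⟨rfl, IsSeqPrefix.nil x⟩
          rw [this, measure_univ, pathWeight]
        | cons b l =>
          rw [pathWeight, ← chainLaw_isSeqPrefix_cons]
          congr 1
          ext x
          simp
      · intro e he
        rw [Measure.map_apply (measurable_seqCons e) (measurableSet_isSeqPrefix _)]
        have : seqCons e ⁻¹' {x : ℕ → E | IsSeqPrefix (a :: l) x} = ∅ := by
          ext x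
          simp [he]
        rw [this, measure_empty, mul_zero]
  · rw [Measure.sum_apply _ MeasurableSet.univ]
    have hp : ∀ e, (chainLaw (K e) K).map (seqCons e) Set.univ = 1 := fun e => by
      rw [Measure.map_apply (measurable_seqCons e) MeasurableSet.univ, Set.preimage_univ,
        measure_univ]
    simp only [Measure.smul_apply, smul_eq_mul, hp, mul_one, measure_univ, hone]

lemma chainLaw_isSeqPrefix (a : E) (l : List E) :
    chainLaw (K a) K {x | IsSeqPrefix l x} = pathWeight K a l := by
  cases l with
  | nil =>
    rw [setOf_isSeqPrefix_nil, measure_univ, pathWeight]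
  | cons b l => exact chainLaw_isSeqPrefix_cons _ K b l

/-- Detaches the deterministic initial state: blocks are read from time 1 on, and the sequence from
time 1 on is a chain with initial law `K a`. -/
lemma chainLaw_dirac_eq_map (a : E) :
    chainLaw (Measure.dirac a) K = (chainLaw (K a) K).map (seqCons a) := by
  ext s hs
  rw [chainLaw_eq_bind, Measure.sum_apply _ hs, tsum_eq_single a]
  · simp
  · intro e he
    simp [he.symm]

end ChainLaw

/-! ### The renewal equation and the law of the first elementary trajectory -/

section Renewal

open scoped ENNReal

variable {A : Type*} [DecidableEq A] {S₁ S₂ : Finset A}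

/-- Once the end `q` is fixed, the conditions on the two components are decoupled; this is the
source of the conditional independence. -/
lemma FinTraj.isElementary_iff (s : FinTraj S₁ S₂) :
    s.IsElementary ↔ ∃ q, IsBlock (S₁ ∩ S₂) q s.1.1 ∧ IsBlock (S₁ ∩ S₂) q s.1.2 := by
  refine exists_congr fun q => ?_
  constructor
  · rintro ⟨h, h1, h2⟩
    exact ⟨⟨h, h1⟩, ⟨s.2 ▸ h, h2⟩⟩
  · rintro ⟨h1, h2⟩
    exact ⟨h1.1, h1.2, h2.2⟩

/-- The finite trajectory `s` followed by the maximal trajectory `ω`. -/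
def FinTraj.prepend (s : FinTraj S₁ S₂) (ω : MaxTraj S₁ S₂) : MaxTraj S₁ S₂ :=
  ⟨(seqAppend s.1.1 ω.1.1, seqAppend s.1.2 ω.1.2), by
    rw [seqInduced_seqAppend, seqInduced_seqAppend, s.2, ω.2]⟩

lemma FinTraj.measurable_prepend (s : FinTraj S₁ S₂) : Measurable s.prepend :=
  Measurable.subtype_mk
    (((measurable_seqAppend s.1.1).comp (measurable_fst.comp measurable_subtype_coe)).prodMk
      ((measurable_seqAppend s.1.2).comp (measurable_snd.comp measurable_subtype_coe)))

lemma FinTraj.append_prepend (s t : FinTraj S₁ S₂) (ω : MaxTraj S₁ S₂) :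
    (s.append t).prepend ω = s.prepend (t.prepend ω) :=
  Subtype.ext (Prod.ext (seqAppend_append _ _ _) (seqAppend_append _ _ _))

lemma FinTraj.prepend_mem_cylinder_append {s t : FinTraj S₁ S₂} {ω : MaxTraj S₁ S₂} :
    s.prepend ω ∈ (s.append t).cylinder ↔ ω ∈ t.cylinder :=
  and_congr isSeqPrefix_append_seqAppend isSeqPrefix_append_seqAppend

lemma FinTraj.append_assoc (s t u : FinTraj S₁ S₂) :
    (s.append t).append u = s.append (t.append u) :=
  Subtype.ext (Prod.ext (List.append_assoc _ _ _) (List.append_assoc _ _ _))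

lemma FinTraj.measurableSet_cylinder (s : FinTraj S₁ S₂) : MeasurableSet s.cylinder :=
  ((measurable_fst.comp measurable_subtype_coe) (measurableSet_isSeqPrefix s.1.1)).inter
    ((measurable_snd.comp measurable_subtype_coe) (measurableSet_isSeqPrefix s.1.2))

lemma getLastD_append {E : Type*} (l m : List E) (x : E) :
    (l ++ m).getLastD x = m.getLastD (l.getLastD x) := by
  simp only [List.getLastD_eq_getLast?, List.getLast?_append]
  cases m.getLast? <;> simp

lemma FinTraj.gamma_append (s t : FinTraj S₁ S₂) (α : S₁ × S₂) :
    (s.append t).gamma α = t.gamma (s.gamma α) :=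
  Prod.ext (getLastD_append _ _ _) (getLastD_append _ _ _)

lemma Elem.gamma_eq (σ : Elem S₁ S₂) (α : S₁ × S₂) : σ.1.gamma α = σ.gamma := by
  refine Prod.ext ?_ ?_
  · simp [FinTraj.gamma, Elem.gamma, List.getLastD_eq_getLast?,
      List.getLast?_eq_getLast_of_ne_nil σ.left_ne_nil]
  · simp [FinTraj.gamma, Elem.gamma, List.getLastD_eq_getLast?,
      List.getLast?_eq_getLast_of_ne_nil σ.right_ne_nil]

lemma concat_seqCons (σ : Elem S₁ S₂) (f : ℕ → Elem S₁ S₂) :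
    concat (seqCons σ f) = σ.1.prepend (concat f) :=
  Subtype.ext (Prod.ext
    (seqConcat_eq_seqAppend _ _ (fun _ => Elem.left_ne_nil _) (fun k => (f k).left_ne_nil)
      fun _ => rfl)
    (seqConcat_eq_seqAppend _ _ (fun _ => Elem.right_ne_nil _) (fun k => (f k).right_ne_nil)
      fun _ => rfl))

variable (M₁ : PosTransitionMatrix S₁) (M₂ : PosTransitionMatrix S₂)

lemma isProbabilityMeasure_syncProduct (hQ : (S₁ ∩ S₂).Nonempty) (α : S₁ × S₂) :
    IsProbabilityMeasure (syncProduct M₁ M₂ α) := by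
  have := isProbabilityMeasure_elemLaw hQ M₁ M₂ α
  exact Measure.isProbabilityMeasure_map measurable_concat.aemeasurable

/-- Decomposition of the synchronization product according to the first elementary trajectory. -/
lemma syncProduct_apply (hQ : (S₁ ∩ S₂).Nonempty) (α : S₁ × S₂) {s : Set (MaxTraj S₁ S₂)}
    (hs : MeasurableSet s) :
    syncProduct M₁ M₂ α s =
      ∑' σ : Elem S₁ S₂, elemLaw M₁ M₂ α {σ} * syncProduct M₁ M₂ σ.gamma (σ.1.prepend ⁻¹' s) := by
  have := isProbabilityMeasure_elemLaw hQ M₁ M₂ α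
  rw [syncProduct, Measure.map_apply measurable_concat hs, chainLaw_eq_bind,
    Measure.sum_apply _ (measurable_concat hs)]
  refine tsum_congr fun σ => ?_
  rw [Measure.smul_apply, smul_eq_mul, Measure.map_apply (measurable_seqCons σ)
    (measurable_concat hs), syncProduct, Measure.map_apply measurable_concat
    (σ.1.measurable_prepend hs)]
  congr 2
  ext f
  simp only [Set.mem_preimage, concat_seqCons]

lemma PosTransitionMatrix.law_tail_isSeqPrefix {S : Finset A} (M : PosTransitionMatrix S) (x : S)
    (l : List S) :
    M.law x {ω | IsSeqPrefix l (fun n => ω (n + 1))} = pathWeight M.kernel x l := by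
  have hm : MeasurableSet {ω : ℕ → S | IsSeqPrefix l (fun n => ω (n + 1))} :=
    (measurable_pi_lambda (fun (ω : ℕ → S) n => ω (n + 1)) fun n => measurable_pi_apply (n + 1))
      (measurableSet_isSeqPrefix l)
  rw [PosTransitionMatrix.law, chainLaw_dirac_eq_map, Measure.map_apply (measurable_seqCons x) hm]
  exact chainLaw_isSeqPrefix M.kernel x l

/-- When Q is hit, `firstBlock` is a block and a prefix of the shifted sequence, and two blocks that
are prefixes of one sequence coincide. -/
lemma hits_and_firstBlock_eq_iff {Q S : Finset A} {q : A} {l : List S} (hl : IsBlock Q q l)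
    (x : ℕ → S) :
    Hits Q x ∧ firstBlock Q x = l ↔ IsSeqPrefix l (fun n => x (n + 1)) := by
  have hpre : IsSeqPrefix (firstBlock Q x) (fun n => x (n + 1)) := by
    simp [IsSeqPrefix, firstBlock, seqTake]
  constructor
  · rintro ⟨-, rfl⟩
    exact hpre
  · intro h
    have hits : Hits Q x := by
      have hpos := List.length_pos_iff.2 hl.ne_nil
      have h1 := isSeqPrefix_iff_getElem.1 h (l.length - 1) (by omega)
      refine ⟨l.length - 1 + 1, by omega, ?_⟩
      have h2 := hl.getLastD l[0]
      rw [List.getLastD_eq_getLast?, List.getLast?_eq_getLast_of_ne_nil hl.ne_nil,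
        Option.getD_some, List.getLast_eq_getElem] at h2
      have h3 : (x (l.length - 1 + 1) : A) = q := by rw [← h2, h1]
      rw [h3]
      exact hl.mem
    have hb : IsBlock Q (x (hitTime Q x) : A) (firstBlock Q x) := by
      have := firstBlock_spec Q x hits
      exact ⟨this.1, by rw [this.2]; rfl⟩
    refine ⟨hits, ?_⟩
    rcases hpre.prefix_or_prefix h with h' | h'
    · exact hb.eq_of_prefix hl h'
    · exact (hl.eq_of_prefix hb h').symm

/-- The probability that two independent chains started at the components of `α` meet. -/
def meetWeight (α : S₁ × S₂) : ℝ≥0∞ := (M₁.law α.1).prod (M₂.law α.2) (meetSet S₁ S₂)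

lemma meetWeight_ne_zero (hQ : (S₁ ∩ S₂).Nonempty) (α : S₁ × S₂) : meetWeight M₁ M₂ α ≠ 0 :=
  (meetSet_pos hQ M₁ M₂ α).ne'

lemma meetWeight_ne_top (α : S₁ × S₂) : meetWeight M₁ M₂ α ≠ ∞ := measure_ne_top _ _

/-- The components of σ end at the same `q`, so two paths that start with them lie in Δ
automatically. The event that the first elementary trajectory is σ is thus a rectangle, and the
conditioning contributes only a constant. -/
lemma elemLaw_singleton (α : S₁ × S₂) (σ : Elem S₁ S₂) :
    elemLaw M₁ M₂ α {σ} = (meetWeight M₁ M₂ α)⁻¹ *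
      (pathWeight M₁.kernel α.1 σ.1.1.1 * pathWeight M₂.kernel α.2 σ.1.1.2) := by
  obtain ⟨q, hb1, hb2⟩ := (FinTraj.isElementary_iff _).1 σ.2
  rw [elemLaw, Measure.map_apply measurable_firstElem (MeasurableSet.singleton σ),
    comap_subtype_coe_apply measurableSet_meetSet, cond_apply measurableSet_meetSet, meetWeight,
    ← M₁.law_tail_isSeqPrefix, ← M₂.law_tail_isSeqPrefix, ← Measure.prod_prod]
  congr 2
  ext ⟨x, y⟩
  have hx := hits_and_firstBlock_eq_iff hb1 x
  have hy := hits_and_firstBlock_eq_iff hb2 y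
  simp only [Set.mem_inter_iff, Set.mem_image, Set.mem_preimage, Set.mem_singleton_iff,
    Set.mem_prod, Set.mem_ofPred_eq, ← hx, ← hy, Subtype.exists, exists_and_right, exists_eq_right]
  constructor
  · rintro ⟨hm, hm', h⟩
    subst h
    exact ⟨⟨hm.1, rfl⟩, ⟨hm.2.1, rfl⟩⟩
  · rintro ⟨⟨hx1, hx2⟩, ⟨hy1, hy2⟩⟩
    have ex := (firstBlock_spec (S₁ ∩ S₂) x hx1).2
    have ey := (firstBlock_spec (S₁ ∩ S₂) y hy1).2
    have ex' := hb1.2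
    have ey' := hb2.2
    rw [← hx2, ex, Option.map_some, Option.some_inj] at ex'
    rw [← hy2, ey, Option.map_some, Option.some_inj] at ey'
    have hm : (x, y) ∈ meetSet S₁ S₂ := ⟨hx1, hy1, ex'.trans ey'.symm⟩
    exact ⟨hm, hm, Subtype.ext (Subtype.ext (Prod.ext hx2 hy2))⟩

end Renewal

/-! ### The Markov property -/

section Markov

open scoped ENNReal

variable {A : Type*} [DecidableEq A] {S₁ S₂ : Finset A}

/-- The empty finite trajectory. -/
def FinTraj.empty : FinTraj S₁ S₂ := ⟨([], []), rfl⟩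

lemma FinTraj.append_empty (s : FinTraj S₁ S₂) : s.append FinTraj.empty = s :=
  Subtype.ext (Prod.ext (List.append_nil _) (List.append_nil _))

lemma FinTraj.cylinder_empty : (FinTraj.empty : FinTraj S₁ S₂).cylinder = Set.univ :=
  Set.eq_univ_of_forall fun _ => ⟨IsSeqPrefix.nil _, IsSeqPrefix.nil _⟩

lemma isElementary_append_iff {r s : FinTraj S₁ S₂} (hr : listInduced (S₁ ∩ S₂) r.1.1 = []) :
    (r.append s).IsElementary ↔ s.IsElementary := by
  rw [FinTraj.isElementary_iff, FinTraj.isElementary_iff]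
  exact exists_congr fun q => and_congr (isBlock_append_iff hr) (isBlock_append_iff (r.2 ▸ hr))

/-- The words are comparable, and a block cannot be a prefix of a word without element of Q. -/
lemma IsBlock.exists_append_of_isSeqPrefix {Q S : Finset A} {q : A} {r b : List S}
    (hb : IsBlock Q q b) (hr : listInduced Q r = []) {x : ℕ → S}
    (h : IsSeqPrefix r (seqAppend b x)) : r <+: b := by
  rcases h.prefix_or_prefix (isSeqPrefix_seqAppend b x) with h | ⟨c, rfl⟩
  · exact h
  · rw [listInduced_append, hb.1] at hr
    simp at hr

lemma IsBlock.eq_of_isSeqPrefix {Q S : Finset A} {q q' : A} {b b' : List S}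
    (hb : IsBlock Q q b) (hb' : IsBlock Q q' b') {x : ℕ → S}
    (h : IsSeqPrefix b' (seqAppend b x)) : b = b' := by
  rcases h.prefix_or_prefix (isSeqPrefix_seqAppend b x) with h | h
  · exact (hb'.eq_of_prefix hb h).symm
  · exact hb.eq_of_prefix hb' h

variable (M₁ : PosTransitionMatrix S₁) (M₂ : PosTransitionMatrix S₂)

/-- By prefix-freeness, the paths in the cylinder have σ as first elementary trajectory, so a single
term of the renewal sum remains. -/
lemma syncProduct_cylinder_elem_append (hQ : (S₁ ∩ S₂).Nonempty) (α : S₁ × S₂) (σ : Elem S₁ S₂)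
    (t : FinTraj S₁ S₂) :
    syncProduct M₁ M₂ α (σ.1.append t).cylinder =
      elemLaw M₁ M₂ α {σ} * syncProduct M₁ M₂ σ.gamma t.cylinder := by
  rw [syncProduct_apply M₁ M₂ hQ α (FinTraj.measurableSet_cylinder _), tsum_eq_single σ]
  · congr 2
    ext ω
    exact FinTraj.prepend_mem_cylinder_append
  · intro ρ hρ
    have : ρ.1.prepend ⁻¹' (σ.1.append t).cylinder = ∅ := by
      refine Set.eq_empty_iff_forall_notMem.2 fun ω hω => hρ ?_
      obtain ⟨q, h1, h2⟩ := (FinTraj.isElementary_iff _).1 σ.2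
      obtain ⟨q', h1', h2'⟩ := (FinTraj.isElementary_iff _).1 ρ.2
      exact Subtype.ext (Subtype.ext (Prod.ext
        (h1'.eq_of_isSeqPrefix h1 (isSeqPrefix_append.1 hω.1).1)
        (h2'.eq_of_isSeqPrefix h2 (isSeqPrefix_append.1 hω.2).1)))
    rw [this, measure_empty, mul_zero]

/-- The renewal sums at α and at `r.gamma α` are matched term by term through ρ ↦ r·ρ. The weights
have a ratio independent of ρ, because the path weight of r·ρ is that of `r` times that of ρ started
at `r.gamma α`. -/
lemma exists_syncProduct_cylinder_append_of_listInduced_eq_nil (hQ : (S₁ ∩ S₂).Nonempty)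
    (α : S₁ × S₂) (r : FinTraj S₁ S₂) (hr : listInduced (S₁ ∩ S₂) r.1.1 = []) :
    ∃ c : ℝ≥0∞, ∀ t : FinTraj S₁ S₂, syncProduct M₁ M₂ α (r.append t).cylinder =
      c * syncProduct M₁ M₂ (r.gamma α) t.cylinder := by
  have hr2 : listInduced (S₁ ∩ S₂) r.1.2 = [] := r.2 ▸ hr
  -- The ratio of the weights U_α(r·ρ) and U_γ(ρ), with γ = `r.gamma α`: the normalization at γ is
  -- undone and the one at α put in its place.
  refine ⟨(meetWeight M₁ M₂ α)⁻¹ *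
    (pathWeight M₁.kernel α.1 r.1.1 * pathWeight M₂.kernel α.2 r.1.2) *
      meetWeight M₁ M₂ (r.gamma α), fun t => ?_⟩
  let g : Elem S₁ S₂ → Elem S₁ S₂ := fun ρ => ⟨r.append ρ.1, (isElementary_append_iff hr).2 ρ.2⟩
  have hg : Function.Injective g := by
    intro ρ ρ' h
    have h' := congrArg (fun σ : Elem S₁ S₂ => σ.1.1) h
    exact Subtype.ext (Subtype.ext (Prod.ext (List.append_cancel_left (congrArg Prod.fst h'))
      (List.append_cancel_left (congrArg Prod.snd h'))))
  rw [syncProduct_apply M₁ M₂ hQ α (FinTraj.measurableSet_cylinder _),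
    syncProduct_apply M₁ M₂ hQ (r.gamma α) (FinTraj.measurableSet_cylinder _),
    ← hg.tsum_eq, ← ENNReal.tsum_mul_left]
  · refine tsum_congr fun ρ => ?_
    have h1 : (g ρ).gamma = ρ.gamma := by
      rw [← (g ρ).gamma_eq α, FinTraj.gamma_append, ρ.gamma_eq]
    have h2 : (g ρ).1.prepend ⁻¹' (r.append t).cylinder = ρ.1.prepend ⁻¹' t.cylinder := by
      ext ω
      rw [Set.mem_preimage, FinTraj.append_prepend, FinTraj.prepend_mem_cylinder_append]
      rfl
    have h3 : elemLaw M₁ M₂ α {g ρ} = (meetWeight M₁ M₂ α)⁻¹ *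
        (pathWeight M₁.kernel α.1 r.1.1 * pathWeight M₂.kernel α.2 r.1.2) *
        meetWeight M₁ M₂ (r.gamma α) * elemLaw M₁ M₂ (r.gamma α) {ρ} := by
      rw [elemLaw_singleton, elemLaw_singleton]
      simp only [g, FinTraj.append, pathWeight_append, FinTraj.gamma]
      rw [mul_assoc _ (meetWeight M₁ M₂ _), ← mul_assoc (meetWeight M₁ M₂ _),
        ENNReal.mul_inv_cancel (meetWeight_ne_zero M₁ M₂ hQ _) (meetWeight_ne_top M₁ M₂ _),
        one_mul]
      ring
    rw [h1, h2, h3, mul_assoc]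
  -- A nonzero term comes from a σ compatible with `r`; each component of `r` is then a prefix of
  -- that of σ, and what is left of σ is elementary.
  · intro σ hσ
    obtain ⟨ω, hω⟩ : (σ.1.prepend ⁻¹' (r.append t).cylinder).Nonempty := by
      by_contra h
      rw [Set.not_nonempty_iff_eq_empty] at h
      exact hσ (by simp only [h, measure_empty, mul_zero])
    obtain ⟨q, hq1, hq2⟩ := (FinTraj.isElementary_iff _).1 σ.2
    obtain ⟨c1, h1⟩ := hq1.exists_append_of_isSeqPrefix hr (isSeqPrefix_append.1 hω.1).1
    obtain ⟨c2, h2⟩ := hq2.exists_append_of_isSeqPrefix hr2 (isSeqPrefix_append.1 hω.2).1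
    rw [← h1, isBlock_append_iff hr] at hq1
    rw [← h2, isBlock_append_iff hr2] at hq2
    let c : FinTraj S₁ S₂ := ⟨(c1, c2), hq1.1.trans hq2.1.symm⟩
    exact ⟨⟨c, (FinTraj.isElementary_iff c).2 ⟨q, hq1, hq2⟩⟩,
      Subtype.ext (Subtype.ext (Prod.ext h1 h2))⟩

/-- Induction on the synchronizations of `s`, peeling off one elementary trajectory each time. The
constant is left unspecified, which spares computing the probability of `s.cylinder`. -/
lemma exists_syncProduct_cylinder_append (hQ : (S₁ ∩ S₂).Nonempty)
    (α : S₁ × S₂) (s : FinTraj S₁ S₂) :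
    ∃ c : ℝ≥0∞, ∀ t : FinTraj S₁ S₂, syncProduct M₁ M₂ α (s.append t).cylinder =
      c * syncProduct M₁ M₂ (s.gamma α) t.cylinder := by
  generalize hl : listInduced (S₁ ∩ S₂) s.1.1 = l
  induction l generalizing s α with
  | nil => exact exists_syncProduct_cylinder_append_of_listInduced_eq_nil M₁ M₂ hQ α s hl
  | cons q l ih =>
    obtain ⟨b1, m1, h1, hb1, hm1⟩ := exists_isBlock_append hl
    obtain ⟨b2, m2, h2, hb2, hm2⟩ := exists_isBlock_append (s.2 ▸ hl)
    let b : FinTraj S₁ S₂ := ⟨(b1, b2), hb1.1.trans hb2.1.symm⟩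
    let σ : Elem S₁ S₂ := ⟨b, (FinTraj.isElementary_iff b).2 ⟨q, hb1, hb2⟩⟩
    let m : FinTraj S₁ S₂ := ⟨(m1, m2), hm1.trans hm2.symm⟩
    obtain rfl : s = σ.1.append m := Subtype.ext (Prod.ext h1 h2)
    obtain ⟨c, hc⟩ := ih σ.gamma m hm1
    refine ⟨elemLaw M₁ M₂ α {σ} * c, fun t => ?_⟩
    rw [FinTraj.append_assoc, syncProduct_cylinder_elem_append M₁ M₂ hQ, hc, mul_assoc,
      FinTraj.gamma_append, σ.gamma_eq]

/-- The Markov property in product form. -/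
lemma syncProduct_cylinder_append (hQ : (S₁ ∩ S₂).Nonempty) (α : S₁ × S₂) (s t : FinTraj S₁ S₂) :
    syncProduct M₁ M₂ α (s.append t).cylinder =
      syncProduct M₁ M₂ α s.cylinder * syncProduct M₁ M₂ (s.gamma α) t.cylinder := by
  obtain ⟨c, hc⟩ := exists_syncProduct_cylinder_append M₁ M₂ hQ α s
  have := isProbabilityMeasure_syncProduct M₁ M₂ hQ (s.gamma α)
  -- The empty `t` has cylinder Ω, which identifies the constant.
  have h := hc FinTraj.empty
  rw [FinTraj.append_empty, FinTraj.cylinder_empty, measure_univ, mul_one] at h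
  rw [hc, h]

/-- A last state in Q of a nonempty component is the last term of the common Q-sequence. Hence if
both final states are in Q, either both components are nonempty and end at that term, or both are
empty and the state is still α. -/
lemma FinTraj.gamma_mem_syncStates {α : S₁ × S₂} (hα : α ∈ syncStates S₁ S₂)
    (s : FinTraj S₁ S₂) : s.gamma α ∈ syncStates S₁ S₂ := by
  rintro ⟨h1, h2⟩
  have key : ∀ {S : Finset A} (l : List S) (x : S), (l.getLastD x : A) ∈ S₁ ∩ S₂ →
      (l = [] ∧ listInduced (S₁ ∩ S₂) l = []) ∨
        (listInduced (S₁ ∩ S₂) l).getLast? = some (l.getLastD x : A) := by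
    intro S l x h
    by_cases hl : l = []
    · subst hl
      exact Or.inl ⟨rfl, rfl⟩
    · right
      have e : l.getLastD x = l.getLast hl := by
        rw [List.getLastD_eq_getLast?, List.getLast?_eq_getLast_of_ne_nil hl, Option.getD_some]
      rw [e] at h ⊢
      exact getLast?_listInduced_of_mem hl h
  have hs := s.2
  rcases key _ _ h1 with ⟨e1, n1⟩ | k1 <;> rcases key _ _ h2 with ⟨e2, n2⟩ | k2
  · simp only [FinTraj.gamma, e1, e2] at h1 h2 ⊢
    exact hα ⟨h1, h2⟩
  · rw [← hs, n1] at k2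
    simp at k2
  · rw [hs, n2] at k1
    simp at k1
  · rw [hs, k2, Option.some_inj] at k1
    exact k1.symm

lemma isMarkovTwoComponentProcess_syncProduct (hQ : (S₁ ∩ S₂).Nonempty) :
    IsMarkovTwoComponentProcess (syncStates S₁ S₂) (syncProduct M₁ M₂) where
  isProbabilityMeasure α _ := isProbabilityMeasure_syncProduct M₁ M₂ hQ α
  mem_of_reachable _ hα s _ := s.gamma_mem_syncStates hα
  markov α _ s hs := by
    have := isProbabilityMeasure_syncProduct M₁ M₂ hQ α
    refine ⟨isProbabilityMeasure_syncProduct M₁ M₂ hQ _, fun t => ?_⟩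
    rw [syncProduct_cylinder_append M₁ M₂ hQ, mul_comm,
      ENNReal.mul_div_cancel_right hs.ne' (measure_ne_top _ _)]

end Markov

/-! ### Factorization of the two components along a given synchronization sequence -/

section Factorization

open scoped ENNReal

variable {A : Type*} [DecidableEq A]

/-- A set of infinite sequences is determined by the first `n` blocks if it contains all or none of
the sequences that start with any given `n` blocks. -/
def IsBlockDetermined (Q : Finset A) {S : Finset A} : ℕ → Set (ℕ → S) → Prop
  | 0, s => s = ∅ ∨ s = Set.univ
  | n + 1, s => ∀ q b, IsBlock Q q b → IsBlockDetermined Q n (seqAppend b ⁻¹' s)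

section

variable (Q : Finset A) {S : Finset A}

lemma isBlockDetermined_of_trivial (n : ℕ) {s : Set (ℕ → S)} (hs : s = ∅ ∨ s = Set.univ) :
    IsBlockDetermined Q n s := by
  induction n generalizing s with
  | zero => exact hs
  | succ n ih =>
    intro q b _
    refine ih ?_
    rcases hs with rfl | rfl
    · exact Or.inl rfl
    · exact Or.inr rfl

/-- Each block uses up one element of Q, so a word with fewer than `n` of them is confirmed or
refuted within `n` blocks. The alternative `l = []` handles `n = 0`. -/
lemma isBlockDetermined_isSeqPrefix (n : ℕ) (l : List S)
    (hl : l = [] ∨ (listInduced Q l).length < n) :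
    IsBlockDetermined Q n {x : ℕ → S | IsSeqPrefix l x} := by
  induction n generalizing l with
  | zero =>
    rcases hl with rfl | hl
    · exact Or.inr setOf_isSeqPrefix_nil
    · omega
  | succ n ih =>
    intro q b hb
    by_cases h1 : l <+: b
    · refine isBlockDetermined_of_trivial Q n (Or.inr (Set.eq_univ_of_forall fun x => ?_))
      exact (isSeqPrefix_seqAppend b x).of_prefix h1
    by_cases h2 : b <+: l
    · obtain ⟨m, rfl⟩ := h2
      have e : seqAppend b ⁻¹' {x : ℕ → S | IsSeqPrefix (b ++ m) x} = {x | IsSeqPrefix m x} :=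
        Set.ext fun x => isSeqPrefix_append_seqAppend
      rw [e]
      refine ih m (Or.inr ?_)
      rw [listInduced_append, hb.1] at hl
      rcases hl with hl | hl
      · exact absurd (List.append_eq_nil_iff.1 hl).1 hb.ne_nil
      · simp only [List.length_append, List.length_singleton] at hl
        omega
    · refine isBlockDetermined_of_trivial Q n (Or.inl (Set.eq_empty_iff_forall_notMem.2 ?_))
      intro x hx
      exact (IsSeqPrefix.prefix_or_prefix hx (isSeqPrefix_seqAppend b x)).elim h1 h2

end

variable {S₁ S₂ : Finset A}

lemma syncSeq_prepend (σ : Elem S₁ S₂) {q : A} (hq : IsBlock (S₁ ∩ S₂) q σ.1.1.1)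
    (ω : MaxTraj S₁ S₂) :
    (fun n => syncSeq n (σ.1.prepend ω)) = seqCons (some q) (fun n => syncSeq n ω) := by
  have : (fun n => syncSeq n (σ.1.prepend ω)) =
      seqInduced (S₁ ∩ S₂) (seqAppend σ.1.1.1 ω.1.1) := rfl
  rw [this, seqInduced_seqAppend, hq.1]
  rfl

lemma measurableSet_syncSeq (n : ℕ) (U : Set (Option A)) :
    MeasurableSet {ω : MaxTraj S₁ S₂ | syncSeq n ω ∈ U} :=
  (measurable_fst.comp measurable_subtype_coe) (measurable_seqInduced _ n (t := U) trivial)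

lemma measurableSet_syncSeq_isSeqPrefix (l : List (Option A)) :
    MeasurableSet {ω : MaxTraj S₁ S₂ | IsSeqPrefix l (fun n => syncSeq n ω)} := by
  simp only [isSeqPrefix_iff_getElem, Set.ofPred_forall]
  exact MeasurableSet.iInter fun i => MeasurableSet.iInter fun hi =>
    measurableSet_syncSeq i {l[i]}

/-- The event that `ω¹ ∈ s`, `ω² ∈ t` and that the synchronization sequence starts with `l`. -/
def syncEvent (l : List A) (s : Set (ℕ → S₁)) (t : Set (ℕ → S₂)) : Set (MaxTraj S₁ S₂) :=
  {ω | ω.1.1 ∈ s ∧ ω.1.2 ∈ t ∧ IsSeqPrefix (l.map some) (fun n => syncSeq n ω)}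

lemma measurableSet_syncEvent (l : List A) {s : Set (ℕ → S₁)} {t : Set (ℕ → S₂)}
    (hs : MeasurableSet s) (ht : MeasurableSet t) : MeasurableSet (syncEvent l s t) :=
  ((measurable_fst.comp measurable_subtype_coe) hs).inter
    (((measurable_snd.comp measurable_subtype_coe) ht).inter
      (measurableSet_syncSeq_isSeqPrefix _))

lemma prepend_preimage_syncEvent_cons {σ : Elem S₁ S₂} {q : A}
    (hσ : IsBlock (S₁ ∩ S₂) q σ.1.1.1) (l : List A) (s : Set (ℕ → S₁)) (t : Set (ℕ → S₂)) :
    σ.1.prepend ⁻¹' syncEvent (q :: l) s t =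
      syncEvent l (seqAppend σ.1.1.1 ⁻¹' s) (seqAppend σ.1.1.2 ⁻¹' t) := by
  ext ω
  simp only [syncEvent, Set.mem_preimage, Set.mem_ofPred_eq, syncSeq_prepend σ hσ, List.map_cons,
    isSeqPrefix_cons_seqCons, true_and]
  rfl

lemma prepend_preimage_syncEvent_cons_of_ne {σ : Elem S₁ S₂} {q q' : A}
    (hσ : IsBlock (S₁ ∩ S₂) q' σ.1.1.1) (h : q' ≠ q) (l : List A) (s : Set (ℕ → S₁))
    (t : Set (ℕ → S₂)) : σ.1.prepend ⁻¹' syncEvent (q :: l) s t = ∅ := by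
  refine Set.eq_empty_iff_forall_notMem.2 fun ω hω => ?_
  have h' := hω.2.2
  rw [syncSeq_prepend σ hσ, List.map_cons, isSeqPrefix_cons_seqCons, Option.some_inj] at h'
  exact h h'.1

variable (M₁ : PosTransitionMatrix S₁) (M₂ : PosTransitionMatrix S₂)

/-- On the event that the synchronization sequence starts with `l`, the probability of events
determined by the first blocks of the two components factorizes. -/
lemma exists_syncProduct_syncEvent_eq_mul (hQ : (S₁ ∩ S₂).Nonempty) (l : List A) (α : S₁ × S₂) :
    ∃ (J₁ : Set (ℕ → S₁) → ℝ≥0∞) (J₂ : Set (ℕ → S₂) → ℝ≥0∞), ∀ s t,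
      MeasurableSet s → MeasurableSet t →
      IsBlockDetermined (S₁ ∩ S₂) l.length s → IsBlockDetermined (S₁ ∩ S₂) l.length t →
      syncProduct M₁ M₂ α (syncEvent l s t) = J₁ s * J₂ t := by
  induction l generalizing α with
  | nil =>
    have := isProbabilityMeasure_syncProduct M₁ M₂ hQ α
    classical
    -- Sets determined by zero blocks are empty or full, so the indicator of nonemptiness suffices.
    refine ⟨fun s => if s = ∅ then 0 else 1, fun t => if t = ∅ then 0 else 1, ?_⟩
    have hne₁ : (Set.univ : Set (ℕ → S₁)) ≠ ∅ :=
      (Set.nonempty_of_mem (Set.mem_univ fun _ => α.1)).ne_empty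
    have hne₂ : (Set.univ : Set (ℕ → S₂)) ≠ ∅ :=
      (Set.nonempty_of_mem (Set.mem_univ fun _ => α.2)).ne_empty
    rintro s t - - (rfl | rfl) (rfl | rfl)
    · simp [syncEvent]
    · simp [syncEvent]
    · simp [syncEvent]
    · beta_reduce
      rw [if_neg hne₁, if_neg hne₂, one_mul]
      have : syncEvent [] (Set.univ : Set (ℕ → S₁)) (Set.univ : Set (ℕ → S₂)) = Set.univ :=
        Set.eq_univ_of_forall fun ω => ⟨trivial, trivial, IsSeqPrefix.nil _⟩
      rw [this, measure_univ]
  | cons q l ih =>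
    by_cases hq : q ∈ S₁ ∩ S₂
    -- The state (q,q) reached after any first elementary trajectory ending at `q`: what follows
    -- does not depend on which blocks led there.
    · let β : S₁ × S₂ := (⟨q, (Finset.mem_inter.1 hq).1⟩, ⟨q, (Finset.mem_inter.1 hq).2⟩)
      obtain ⟨J₁, J₂, hJ⟩ := ih β
      -- Each factor sums over the blocks of its own site; the normalization is put, arbitrarily,
      -- into the first one.
      refine ⟨fun s => (meetWeight M₁ M₂ α)⁻¹ * ∑' b : {b : List S₁ // IsBlock (S₁ ∩ S₂) q b},
        pathWeight M₁.kernel α.1 b * J₁ (seqAppend b ⁻¹' s),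
        fun t => ∑' b : {b : List S₂ // IsBlock (S₁ ∩ S₂) q b},
          pathWeight M₂.kernel α.2 b * J₂ (seqAppend b ⁻¹' t), fun s t hs ht hds hdt => ?_⟩
      -- Pairs of blocks ending at `q` parametrize the elementary trajectories ending at `q`, so the
      -- renewal sum is a double sum over a full product.
      let g : {b : List S₁ // IsBlock (S₁ ∩ S₂) q b} × {b : List S₂ // IsBlock (S₁ ∩ S₂) q b} →
          Elem S₁ S₂ := fun p => ⟨⟨(p.1.1, p.2.1), p.1.2.1.trans p.2.2.1.symm⟩,
            (FinTraj.isElementary_iff _).2 ⟨q, p.1.2, p.2.2⟩⟩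
      have hg : Function.Injective g := by
        intro p p' h
        have h' := congrArg (fun σ : Elem S₁ S₂ => σ.1.1) h
        exact Prod.ext (Subtype.ext (congrArg Prod.fst h')) (Subtype.ext (congrArg Prod.snd h'))
      rw [syncProduct_apply M₁ M₂ hQ α (measurableSet_syncEvent _ hs ht), ← hg.tsum_eq]
      · beta_reduce
        rw [mul_assoc, ← ENNReal.tsum_mul_right]
        simp_rw [← ENNReal.tsum_mul_left]
        rw [← ENNReal.tsum_prod]
        refine tsum_congr fun ⟨b, b'⟩ => ?_
        have hγ : (g (b, b')).gamma = β := by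
          rw [← (g (b, b')).gamma_eq α]
          exact Prod.ext (Subtype.ext (b.2.getLastD _)) (Subtype.ext (b'.2.getLastD _))
        rw [prepend_preimage_syncEvent_cons (σ := g (b, b')) b.2, hγ, hJ _ _
          (measurable_seqAppend _ hs) (measurable_seqAppend _ ht) (hds q _ b.2) (hdt q _ b'.2),
          elemLaw_singleton]
        simp only [g]
        ring
      · intro σ hσ
        obtain ⟨q', h1, h2⟩ := (FinTraj.isElementary_iff _).1 σ.2
        by_cases hqq : q' = q
        · subst hqq
          exact ⟨(⟨_, h1⟩, ⟨_, h2⟩), rfl⟩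
        · exact absurd (by simp only [prepend_preimage_syncEvent_cons_of_ne h1 hqq, measure_empty,
            mul_zero]) hσ
    · refine ⟨0, 0, fun s t hs ht _ _ => ?_⟩
      rw [syncProduct_apply M₁ M₂ hQ α (measurableSet_syncEvent _ hs ht), Pi.zero_apply, zero_mul,
        ENNReal.tsum_eq_zero]
      intro σ
      obtain ⟨q', h1, -⟩ := (FinTraj.isElementary_iff _).1 σ.2
      have hne : q' ≠ q := by
        rintro rfl
        exact hq h1.mem
      rw [prepend_preimage_syncEvent_cons_of_ne h1 hne, measure_empty, mul_zero]

/-- Conditional independence on the event that Y starts with `l`, cross-multiplied because that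
event may be null. -/
lemma syncProduct_syncEvent_mul (hQ : (S₁ ∩ S₂).Nonempty) (l : List A) (α : S₁ × S₂)
    {s : Set (ℕ → S₁)} {t : Set (ℕ → S₂)} (hs : MeasurableSet s) (ht : MeasurableSet t)
    (hds : IsBlockDetermined (S₁ ∩ S₂) l.length s)
    (hdt : IsBlockDetermined (S₁ ∩ S₂) l.length t) :
    syncProduct M₁ M₂ α (syncEvent l s t) * syncProduct M₁ M₂ α (syncEvent l Set.univ Set.univ) =
      syncProduct M₁ M₂ α (syncEvent l s Set.univ) *
        syncProduct M₁ M₂ α (syncEvent l Set.univ t) := by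
  obtain ⟨J₁, J₂, hJ⟩ := exists_syncProduct_syncEvent_eq_mul M₁ M₂ hQ l α
  have hu : ∀ {S : Finset A}, IsBlockDetermined (S₁ ∩ S₂) l.length (Set.univ : Set (ℕ → S)) :=
    isBlockDetermined_of_trivial _ _ (Or.inr rfl)
  rw [hJ _ _ hs ht hds hdt, hJ _ _ .univ .univ hu hu, hJ _ _ hs .univ hds hu,
    hJ _ _ .univ ht hu hdt]
  ring

/-- The first elementary trajectory supplies the term of index 0, and removing it shifts Y, whence
an induction on `n` over all α. -/
lemma ae_syncSeq_ne_none (hQ : (S₁ ∩ S₂).Nonempty) (α : S₁ × S₂) (n : ℕ) :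
    ∀ᵐ ω ∂(syncProduct M₁ M₂ α), syncSeq n ω ≠ none := by
  have key : syncProduct M₁ M₂ α {ω | syncSeq n ω ∈ ({none} : Set (Option A))} = 0 := by
    induction n generalizing α with
    | zero =>
      rw [syncProduct_apply M₁ M₂ hQ α (measurableSet_syncSeq _ _), ENNReal.tsum_eq_zero]
      intro σ
      obtain ⟨q, h1, -⟩ := (FinTraj.isElementary_iff _).1 σ.2
      have : σ.1.prepend ⁻¹' {ω | syncSeq 0 ω ∈ ({none} : Set (Option A))} = ∅ := by
        refine Set.eq_empty_iff_forall_notMem.2 fun ω hω => ?_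
        have h := congrFun (syncSeq_prepend σ h1 ω) 0
        simp only [seqCons_zero] at h
        simp [h] at hω
      rw [this, measure_empty, mul_zero]
    | succ n ih =>
      rw [syncProduct_apply M₁ M₂ hQ α (measurableSet_syncSeq _ _), ENNReal.tsum_eq_zero]
      intro σ
      obtain ⟨q, h1, -⟩ := (FinTraj.isElementary_iff _).1 σ.2
      have : σ.1.prepend ⁻¹' {ω | syncSeq (n + 1) ω ∈ ({none} : Set (Option A))} =
          {ω | syncSeq n ω ∈ ({none} : Set (Option A))} := by
        ext ω
        have h := congrFun (syncSeq_prepend σ h1 ω) (n + 1)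
        simp only [seqCons_succ] at h
        simp [h]
      rw [this, ih, mul_zero]
  rw [ae_iff]
  simpa using key

end Factorization

/-! ### Conditional independence given a random sequence -/

section CondIndep

open Filter Topology

lemma countable_setOf_forall_mem {E : Type*} {R : Set E} (hR : R.Countable) :
    {l : List E | ∀ e ∈ l, e ∈ R}.Countable := by
  have := hR.to_subtype
  refine (Set.countable_range (List.map (Subtype.val : R → E))).mono fun l hl => ?_
  exact ⟨l.attach.map fun e => ⟨e.1, hl e.1 e.2⟩, by simp⟩

/-- Conditional independence of random variables in terms of conditional expectations of bounded
functions. -/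
lemma CondIndepFun.condExp_mul {Ω : Type*} {m mΩ : MeasurableSpace Ω} [StandardBorelSpace Ω] {hm : m ≤ mΩ}
    {μ : Measure Ω} [IsProbabilityMeasure μ] {β γ : Type*} [mβ : MeasurableSpace β] [mγ : MeasurableSpace γ]
    [MeasurableSpace.CountableOrCountablyGenerated Ω (β × γ)] {f : Ω → β} {g : Ω → γ}
    (hf : Measurable f) (hg : Measurable g) (h : CondIndepFun m hm f g μ) {φ ψ : Ω → ℝ}
    (hφ : Measurable[mβ.comap f] φ) (hψ : Measurable[mγ.comap g] ψ)
    (hφi : Integrable φ μ) (hψi : Integrable ψ μ) (hφψi : Integrable (fun ω => φ ω * ψ ω) μ) :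
    μ[fun ω => φ ω * ψ ω | m] =ᵐ[μ] fun ω => (μ[φ | m]) ω * (μ[ψ | m]) ω := by
  have : Nonempty Ω := nonempty_of_isProbabilityMeasure μ
  obtain ⟨φ', hφ', rfl⟩ := hφ.exists_eq_measurable_comp
  obtain ⟨ψ', hψ', rfl⟩ := hψ.exists_eq_measurable_comp
  -- For almost every ω the regular conditional law of `(f, g)` is the product of its marginals, so
  -- the claim is Fubini's theorem for the factorizations of φ through `f` and of ψ through `g`.
  have hk := ae_of_ae_trim hm ((condIndepFun_iff_map_prod_eq_prod_map_map hf hg).1 h)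
  filter_upwards [hk, condExp_ae_eq_integral_condExpKernel hm hφi,
    condExp_ae_eq_integral_condExpKernel hm hψi,
    condExp_ae_eq_integral_condExpKernel hm hφψi] with ω hω h1 h2 h3
  rw [h1, h2, h3]
  have e := Kernel.map_apply (condExpKernel μ m) (hf.prodMk hg) ω
  rw [hω, Kernel.prod_apply, Kernel.map_apply _ hf, Kernel.map_apply _ hg] at e
  have hf' : AEMeasurable f (condExpKernel μ m ω) := hf.aemeasurable
  have hg' : AEMeasurable g (condExpKernel μ m ω) := hg.aemeasurable
  have i1 := integral_map (hf.prodMk hg).aemeasurable (μ := condExpKernel μ m ω)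
    (f := fun p : β × γ => φ' p.1 * ψ' p.2)
    ((hφ'.comp measurable_fst).mul (hψ'.comp measurable_snd)).aestronglyMeasurable
  have i2 := integral_map hf' (f := φ') hφ'.aestronglyMeasurable
  have i3 := integral_map hg' (f := ψ') hψ'.aestronglyMeasurable
  rw [← e, integral_prod_mul, i2, i3] at i1
  exact i1.symm

variable {Ω E : Type*} {mΩ : MeasurableSpace Ω} [mE : MeasurableSpace E]

/-- The `σ`-algebra generated by the first `n` terms of a random sequence. -/
@[reducible]
def initialSigma (Y : ℕ → Ω → E) (n : ℕ) : MeasurableSpace Ω :=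
  MeasurableSpace.comap (fun ω (k : Fin n) => Y k ω) MeasurableSpace.pi

lemma comap_le_initialSigma (Y : ℕ → Ω → E) {k n : ℕ} (h : k < n) :
    MeasurableSpace.comap (Y k) mE ≤ initialSigma Y n := by
  rintro _ ⟨U, hU, rfl⟩
  exact ⟨(fun f : Fin n → E => f ⟨k, h⟩) ⁻¹' U, measurable_pi_apply (⟨k, h⟩ : Fin n) hU, rfl⟩

lemma initialSigma_le_iSup (Y : ℕ → Ω → E) (n : ℕ) :
    initialSigma Y n ≤ ⨆ k : ℕ, MeasurableSpace.comap (Y k) mE := by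
  rw [initialSigma, MeasurableSpace.pi, MeasurableSpace.comap_iSup]
  refine iSup_le fun k => ?_
  rw [MeasurableSpace.comap_comp]
  exact le_iSup (fun k : ℕ => MeasurableSpace.comap (Y k) mE) k

lemma iSup_initialSigma (Y : ℕ → Ω → E) :
    ⨆ n, initialSigma Y n = ⨆ k : ℕ, MeasurableSpace.comap (Y k) mE :=
  le_antisymm (iSup_le (initialSigma_le_iSup Y))
    (iSup_le fun k => (comap_le_initialSigma Y k.lt_succ_self).trans (le_iSup _ (k + 1)))

lemma initialSigma_mono (Y : ℕ → Ω → E) : Monotone (initialSigma Y) := by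
  intro n m h
  conv_lhs => rw [initialSigma, MeasurableSpace.pi, MeasurableSpace.comap_iSup]
  refine iSup_le fun k => ?_
  rw [MeasurableSpace.comap_comp]
  exact comap_le_initialSigma Y (k.2.trans_le h)

/-- The natural filtration of a random sequence, starting from the trivial `σ`-algebra. -/
def initialFiltration {Y : ℕ → Ω → E} (hY : ∀ n, Measurable (Y n)) : Filtration ℕ mΩ where
  seq := initialSigma Y
  mono' := initialSigma_mono Y
  le' n := (initialSigma_le_iSup Y n).trans (iSup_le fun k => (hY k).comap_le)

lemma measurableSet_initialSigma_isSeqPrefix [DiscreteMeasurableSpace E] (Y : ℕ → Ω → E)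
    (l : List E) :
    MeasurableSet[initialSigma Y l.length] {ω | IsSeqPrefix l (fun n => Y n ω)} := by
  refine ⟨{fun k => l[k]}, MeasurableSet.singleton _, ?_⟩
  ext ω
  simp only [Set.mem_preimage, Set.mem_singleton_iff, Set.mem_ofPred_eq, isSeqPrefix_iff_getElem,
    funext_iff, Fin.forall_iff]
  rfl

variable {μ : Measure Ω} [IsProbabilityMeasure μ]

/-- The conditional probability given the first terms of a random sequence, on an atom. -/
lemma condExp_initialSigma_mul [DiscreteMeasurableSpace E] {Y : ℕ → Ω → E}
    (hY : ∀ n, Measurable (Y n)) {s : Set Ω} (hs : MeasurableSet s) (l : List E) {ω : Ω}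
    (hω : IsSeqPrefix l (fun n => Y n ω)) :
    (μ⟦s | initialSigma Y l.length⟧) ω * μ.real {ω | IsSeqPrefix l (fun n => Y n ω)} =
      μ.real (s ∩ {ω | IsSeqPrefix l (fun n => Y n ω)}) := by
  have hle : initialSigma Y l.length ≤ mΩ := (initialFiltration hY).le l.length
  have hC := measurableSet_initialSigma_isSeqPrefix Y l
  have hint : Integrable (s.indicator fun _ => (1 : ℝ)) μ := (integrable_const 1).indicator hs
  have h := setIntegral_condExp hle hint hC
  -- The cylinder is an atom of `initialSigma Y l.length`, so the conditional probability is
  -- constant on it.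
  have hconst : ∀ ω' ∈ {ω | IsSeqPrefix l (fun n => Y n ω)},
      (μ⟦s | initialSigma Y l.length⟧) ω' = (μ⟦s | initialSigma Y l.length⟧) ω := by
    intro ω' hω'
    have hf : Measurable[initialSigma Y l.length] (μ⟦s | initialSigma Y l.length⟧) :=
      stronglyMeasurable_condExp.measurable
    refine Measurable.factorsThrough hf (funext fun k => ?_)
    rw [isSeqPrefix_iff_getElem.1 hω k k.2, isSeqPrefix_iff_getElem.1 hω' k k.2]
  rw [setIntegral_congr_fun (hle _ hC) hconst, setIntegral_const, setIntegral_indicator hs,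
    setIntegral_const, smul_eq_mul, smul_eq_mul, mul_one, Set.inter_comm _ s] at h
  rw [mul_comm, h]

/-- Two events are independent conditionally on a random sequence with values in a countable set if
they are eventually independent on each atom generated by the first terms of the sequence. -/
lemma condExp_inter_of_forall_isSeqPrefix [DiscreteMeasurableSpace E] {Y : ℕ → Ω → E}
    (hY : ∀ n, Measurable (Y n)) {R : Set E} (hR : R.Countable)
    (hYR : ∀ n, ∀ᵐ ω ∂μ, Y n ω ∈ R) {s t : Set Ω} (hs : MeasurableSet s) (ht : MeasurableSet t)
    (n₀ : ℕ) (h : ∀ l : List E, n₀ ≤ l.length → (∀ e ∈ l, e ∈ R) →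
      μ (s ∩ t ∩ {ω | IsSeqPrefix l (fun n => Y n ω)}) * μ {ω | IsSeqPrefix l (fun n => Y n ω)} =
        μ (s ∩ {ω | IsSeqPrefix l (fun n => Y n ω)}) *
          μ (t ∩ {ω | IsSeqPrefix l (fun n => Y n ω)})) :
    μ⟦s ∩ t | ⨆ n, MeasurableSpace.comap (Y n) mE⟧ =ᵐ[μ]
      (μ⟦s | ⨆ n, MeasurableSpace.comap (Y n) mE⟧) *
        (μ⟦t | ⨆ n, MeasurableSpace.comap (Y n) mE⟧) := by
  -- Discards all null atoms at once. Countability of `R` is needed here, as there are then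
  -- countably many words in `R`.
  have hnull : ∀ᵐ ω ∂μ, ∀ l ∈ {l : List E | ∀ e ∈ l, e ∈ R},
      μ {ω | IsSeqPrefix l (fun n => Y n ω)} = 0 → ¬ IsSeqPrefix l (fun n => Y n ω) := by
    rw [ae_ball_iff (countable_setOf_forall_mem hR)]
    intro l _
    by_cases h0 : μ {ω | IsSeqPrefix l (fun n => Y n ω)} = 0
    · have : ∀ᵐ ω ∂μ, ¬ IsSeqPrefix l (fun n => Y n ω) := by
        rw [ae_iff]
        simpa using h0
      filter_upwards [this] with ω hω _ using hω
    · exact Eventually.of_forall fun ω h => absurd h h0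
  have hfin : ∀ᵐ ω ∂μ, ∀ n, n₀ ≤ n → (μ⟦s ∩ t | initialSigma Y n⟧) ω =
      (μ⟦s | initialSigma Y n⟧) ω * (μ⟦t | initialSigma Y n⟧) ω := by
    filter_upwards [hnull, ae_all_iff.2 hYR] with ω hω hωR n hn
    let l := seqTake (fun n => Y n ω) n
    have hlen : l.length = n := by simp [l, seqTake]
    have hl : IsSeqPrefix l (fun n => Y n ω) := by simp [IsSeqPrefix, l, seqTake]
    have hlR : ∀ e ∈ l, e ∈ R := by
      intro e he
      simp only [l, seqTake, List.mem_map] at he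
      obtain ⟨k, -, rfl⟩ := he
      exact hωR k
    have h0 : μ.real {ω | IsSeqPrefix l (fun n => Y n ω)} ≠ 0 := by
      rw [measureReal_ne_zero_iff]
      exact fun h0 => hω l hlR h0 hl
    have hst := condExp_initialSigma_mul (μ := μ) hY (hs.inter ht) l hl
    have hs' := condExp_initialSigma_mul (μ := μ) hY hs l hl
    have ht' := condExp_initialSigma_mul (μ := μ) hY ht l hl
    have hmul := congrArg ENNReal.toReal (h l (hlen ▸ hn) hlR)
    rw [ENNReal.toReal_mul, ENNReal.toReal_mul] at hmul
    change μ.real _ * μ.real _ = μ.real _ * μ.real _ at hmul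
    rw [← hst, ← hs', ← ht', hlen] at hmul
    -- The three conditional probabilities are quotients by the mass of the atom, so its square is
    -- cancelled.
    refine mul_right_cancel₀ (mul_ne_zero h0 h0) ?_
    linear_combination hmul
  -- Lévy's upward theorem along the natural filtration of `Y`.
  have hconv : ∀ u : Set Ω, ∀ᵐ ω ∂μ, Tendsto (fun n => (μ⟦u | initialSigma Y n⟧) ω) atTop
      (𝓝 ((μ⟦u | ⨆ n, MeasurableSpace.comap (Y n) mE⟧) ω)) := by
    intro u
    have := tendsto_ae_condExp (μ := μ) (ℱ := initialFiltration hY) (u.indicator fun _ => (1 : ℝ))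
    have e : ⨆ n, (initialFiltration hY) n = ⨆ n, MeasurableSpace.comap (Y n) mE :=
      iSup_initialSigma Y
    rw [e] at this
    exact this
  filter_upwards [hfin, hconv (s ∩ t), hconv s, hconv t] with ω h1 h2 h3 h4
  refine tendsto_nhds_unique h2 ((h3.mul h4).congr' ?_)
  filter_upwards [eventually_ge_atTop n₀] with n hn using (h1 n hn).symm

end CondIndep

/-! ### The Local Independence Property -/

section LocalIndependence

variable {A : Type*} [DecidableEq A] {S₁ S₂ : Finset A}

lemma mem_of_seqInduced_eq_some {Q S : Finset A} {x : ℕ → S} {n : ℕ} {a : A}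
    (h : seqInduced Q x n = some a) : a ∈ Q := by
  obtain ⟨k, hk, -, rfl⟩ := (seqInduced_eq_some_iff Q).1 h
  exact hk

/-- Makes Ω a measurable part of a standard Borel space, so that regular conditional laws exist. As
`A` may be uncountable, equality of the induced terms is split over the countably many values they
can take. -/
lemma measurableSet_setOf_seqInduced_eq :
    MeasurableSet {p : (ℕ → S₁) × (ℕ → S₂) |
      seqInduced (S₁ ∩ S₂) p.1 = seqInduced (S₁ ∩ S₂) p.2} := by
  simp only [funext_iff, Set.ofPred_forall]
  refine MeasurableSet.iInter fun n => ?_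
  let R : Set (Option A) := insert none (some '' ((S₁ ∩ S₂ : Finset A) : Set A))
  have hR : R.Countable := ((Finset.countable_toSet _).image _).insert _
  have e : {p : (ℕ → S₁) × (ℕ → S₂) |
      seqInduced (S₁ ∩ S₂) p.1 n = seqInduced (S₁ ∩ S₂) p.2 n} =
      ⋃ o ∈ R, {p | seqInduced (S₁ ∩ S₂) p.1 n ∈ ({o} : Set (Option A))} ∩
        {p | seqInduced (S₁ ∩ S₂) p.2 n ∈ ({o} : Set (Option A))} := by
    ext p
    simp only [Set.mem_ofPred_eq, Set.mem_iUnion, Set.mem_inter_iff, Set.mem_singleton_iff,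
      exists_prop]
    constructor
    · intro h
      refine ⟨seqInduced (S₁ ∩ S₂) p.1 n, ?_, rfl, h.symm⟩
      cases ho : seqInduced (S₁ ∩ S₂) p.1 n with
      | none => exact Or.inl rfl
      | some a => exact Or.inr ⟨a, mem_of_seqInduced_eq_some ho, rfl⟩
    · rintro ⟨o, -, h1, h2⟩
      rw [h1, h2]
  rw [e]
  exact MeasurableSet.biUnion hR fun o _ =>
    (measurable_fst (measurable_seqInduced (S₁ ∩ S₂) n (t := {o}) trivial)).inter
      (measurable_snd (measurable_seqInduced (S₁ ∩ S₂) n (t := {o}) trivial))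

instance : StandardBorelSpace (MaxTraj S₁ S₂) := measurableSet_setOf_seqInduced_eq.standardBorel

variable (M₁ : PosTransitionMatrix S₁) (M₂ : PosTransitionMatrix S₂)

/-- The factorization on the events "Y starts with `l`", for long `l`, is what the criterion by
atoms asks for; the countable set of values is Q, as Y almost surely never takes the value `none`.
-/
lemma condExp_isSeqPrefix_inter (hQ : (S₁ ∩ S₂).Nonempty) (α : S₁ × S₂) (l₁ : List S₁)
    (l₂ : List S₂) :
    (syncProduct M₁ M₂ α)⟦{ω | IsSeqPrefix l₁ ω.1.1} ∩ {ω | IsSeqPrefix l₂ ω.1.2} | syncSigma⟧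
      =ᵐ[syncProduct M₁ M₂ α]
        ((syncProduct M₁ M₂ α)⟦{ω | IsSeqPrefix l₁ ω.1.1} | syncSigma⟧) *
          ((syncProduct M₁ M₂ α)⟦{ω | IsSeqPrefix l₂ ω.1.2} | syncSigma⟧) := by
  have := isProbabilityMeasure_syncProduct M₁ M₂ hQ α
  let _ : MeasurableSpace (Option A) := ⊤
  have : DiscreteMeasurableSpace (Option A) := ⟨fun _ => trivial⟩
  have hm₁ := measurableSet_isSeqPrefix l₁
  have hm₂ := measurableSet_isSeqPrefix l₂
  refine condExp_inter_of_forall_isSeqPrefix (Y := syncSeq)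
    (R := some '' ((S₁ ∩ S₂ : Finset A) : Set A)) (fun n U _ => measurableSet_syncSeq n U)
    ((Finset.countable_toSet _).image _) (fun n => ?_)
    ((measurable_fst.comp measurable_subtype_coe) hm₁)
    ((measurable_snd.comp measurable_subtype_coe) hm₂)
    -- One more than the number of elements of Q in either word: from this length on, both cylinders
    -- are determined by the first blocks.
    (max (listInduced (S₁ ∩ S₂) l₁).length (listInduced (S₁ ∩ S₂) l₂).length + 1) ?_
  · filter_upwards [ae_syncSeq_ne_none M₁ M₂ hQ α n] with ω hω
    obtain ⟨a, ha⟩ := Option.ne_none_iff_exists'.1 hω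
    exact ⟨a, mem_of_seqInduced_eq_some ha, ha.symm⟩
  · intro l hl hlR
    obtain ⟨l, rfl⟩ : ∃ m : List A, l = m.map some := by
      have : l ∈ Set.range (List.map (some : A → Option A)) := by
        rw [Set.range_list_map]
        intro o ho
        obtain ⟨a, -, rfl⟩ := hlR o ho
        exact ⟨a, rfl⟩
      obtain ⟨m, rfl⟩ := this
      exact ⟨m, rfl⟩
    rw [List.length_map] at hl
    have h := syncProduct_syncEvent_mul M₁ M₂ hQ l α hm₁ hm₂
      (isBlockDetermined_isSeqPrefix _ _ _ (Or.inr (by omega)))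
      (isBlockDetermined_isSeqPrefix _ _ _ (Or.inr (by omega)))
    simpa only [syncEvent, Set.mem_univ, true_and, Set.mem_ofPred_eq, Set.ofPred_and,
      Set.inter_assoc] using h

/-- Prefix cylinders form a generating π-system on each site, so their conditional independence
extends to the σ-algebras of the components. -/
lemma condIndepFun_syncProduct (hQ : (S₁ ∩ S₂).Nonempty) (α : S₁ × S₂)
    [IsProbabilityMeasure (syncProduct M₁ M₂ α)] :
    CondIndepFun syncSigma syncSigma_le (fun ω : MaxTraj S₁ S₂ => ω.1.1) (fun ω => ω.1.2)
      (syncProduct M₁ M₂ α) := by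
  have hf : Measurable fun ω : MaxTraj S₁ S₂ => ω.1.1 := measurable_fst.comp measurable_subtype_coe
  have hg : Measurable fun ω : MaxTraj S₁ S₂ => ω.1.2 := measurable_snd.comp measurable_subtype_coe
  rw [condIndepFun_iff_condIndep]
  refine CondIndepSets.condIndep hf.comap_le hg.comap_le
    (isPiSystem_isSeqPrefix.comap fun ω : MaxTraj S₁ S₂ => ω.1.1)
    (isPiSystem_isSeqPrefix.comap fun ω : MaxTraj S₁ S₂ => ω.1.2) ?_ ?_ ?_
  · rw [← generateFrom_isSeqPrefix, MeasurableSpace.comap_generateFrom]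
    rfl
  · rw [← generateFrom_isSeqPrefix, MeasurableSpace.comap_generateFrom]
    rfl
  · rw [condIndepSets_iff]
    · rintro _ _ ⟨_, ⟨l₁, rfl⟩, rfl⟩ ⟨_, ⟨l₂, rfl⟩, rfl⟩
      exact condExp_isSeqPrefix_inter M₁ M₂ hQ α l₁ l₂
    · rintro _ ⟨_, ⟨l, rfl⟩, rfl⟩
      exact hf (measurableSet_isSeqPrefix l)
    · rintro _ ⟨_, ⟨l, rfl⟩, rfl⟩
      exact hg (measurableSet_isSeqPrefix l)

lemma condIndepComponents_syncProduct (hQ : (S₁ ∩ S₂).Nonempty) (α : S₁ × S₂) :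
    CondIndepComponents (syncProduct M₁ M₂ α) := by
  have := isProbabilityMeasure_syncProduct M₁ M₂ hQ α
  rintro φ ψ hφ hψ hφ0 hψ0 ⟨C, hC⟩ ⟨D, hD⟩
  have hf : Measurable fun ω : MaxTraj S₁ S₂ => ω.1.1 := measurable_fst.comp measurable_subtype_coe
  have hg : Measurable fun ω : MaxTraj S₁ S₂ => ω.1.2 := measurable_snd.comp measurable_subtype_coe
  have hφm : Measurable φ := hφ.mono hf.comap_le le_rfl
  have hψm : Measurable ψ := hψ.mono hg.comap_le le_rfl
  refine CondIndepFun.condExp_mul hf hg (condIndepFun_syncProduct M₁ M₂ hQ α) hφ hψ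
    (.of_bound hφm.aestronglyMeasurable C (.of_forall fun ω => ?_))
    (.of_bound hψm.aestronglyMeasurable D (.of_forall fun ω => ?_))
    (.of_bound (hφm.mul hψm).aestronglyMeasurable (C * D) (.of_forall fun ω => ?_))
  · rw [Real.norm_of_nonneg (hφ0 ω)]
    exact hC ω
  · rw [Real.norm_of_nonneg (hψ0 ω)]
    exact hD ω
  · rw [Real.norm_of_nonneg (mul_nonneg (hφ0 ω) (hψ0 ω))]
    exact mul_le_mul (hC ω) (hD ω) (hψ0 ω) ((hφ0 ω).trans (hC ω))

end LocalIndependence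

end TwoSite

end

theorem mainTheorem8 {A : Type*} [DecidableEq A] (S₁ S₂ : Finset A)
    (hQ : (S₁ ∩ S₂).Nonempty) (h₁ : (S₁ \ S₂).Nonempty) (h₂ : (S₂ \ S₁).Nonempty)
    (M₁ : TwoSite.PosTransitionMatrix S₁) (M₂ : TwoSite.PosTransitionMatrix S₂) :
    TwoSite.LocalIndependenceProperty (TwoSite.syncStates S₁ S₂) (TwoSite.syncProduct M₁ M₂) where
  toIsMarkovTwoComponentProcess := TwoSite.isMarkovTwoComponentProcess_syncProduct M₁ M₂ hQ
  condIndep α _ := TwoSite.condIndepComponents_syncProduct M₁ M₂ hQ α
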